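/- Let $0<q<1$. For complex numbers put $(a;q)_n=\prod_{k=0}^{n-1}(1-aq^k)$, $(a;q)_\infty=\prod_{k=0}^{\infty}(1-aq^k)$, $(a_1,\dots,a_m;q)_n=(a_1;q)_n\cdots(a_m;q)_n$ for $n$ a nonnegative integer or $\infty$, and $$h(x;a|q)=\prod_{k=0}^{\infty}(1-2q^kax+q^{2k}a^2),\qquad h(x;a_1,\dots,a_m|q)=h(x;a_1|q)\cdots h(x;a_m|q).$$ Let $${}_8W_7(a_1;a_4,\dots,a_8;q,x)=\sum_{n=0}^{\infty}\frac{(a_1,\,q\sqrt{a_1},\,-q\sqrt{a_1},\,a_4,\dots,a_8;q)_n}{(q,\,\sqrt{a_1},\,-\sqrt{a_1},\,qa_1/a_4,\dots,qa_1/a_8;q)_n}\,x^n$$ denote the very-well-poised basic hypergeometric series. **Theorem.** Let $a,b,c,d,r,z$ be complex numbers with $\max\{|a|,|b|,|c|,|d|,|r|\}<1$, $z\neq0$, $|bcdrz|<1$ and $a^2bcdr\neq q$. Then the integrand below is integrable on $[0,\pi]$, the ${}_8W_7$ series below converges absolutely, and $$\int_0^\pi\frac{h(\cos2\theta;1|q)\,h(\cos\theta;abcdrz|q)}{h(\cos\theta;a,b,c,d,r|q)}\,d\theta$$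 $$=\frac{2\pi\,(abcd,abcr,abdr,acdr,a^2bcdrz,bcdrz;q)_\infty}{(q,ab,ac,ad,ar,bc,bd,br,cd,cr,dr,a^2bcdr;q)_\infty}\;{}_8W_7\!\left(\frac{a^2bcdr}{q};\,ab,\,ac,\,ad,\,ar,\,\frac1z;\,q,\,bcdrz\right).$$ Here the last five denominator parameters $qa_1/a_4,\dots,qa_1/a_8$ of the ${}_8W_7$ series are $acdr$, $abdr$, $abcr$, $abcd$, $a^2bcdrz$; these are their values also when some of $a,b,c,d,r$ vanish. -/

import Mathlib

open scoped BigOperators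

noncomputable section

/-- The finite `q`-shifted factorial `(a; q)_n = ∏_{k=0}^{n-1} (1 - a q^k)`. -/
def qShift (q a : ℂ) (n : ℕ) : ℂ := ∏ k ∈ Finset.range n, (1 - a * q ^ k)

/-- The infinite `q`-shifted factorial `(a; q)_∞ = ∏_{k≥0} (1 - a q^k)`
(the product converges whenever `|q| < 1`). -/
def qShiftInf (q a : ℂ) : ℂ := ∏' k : ℕ, (1 - a * q ^ k)

/-- The multiple `q`-shifted factorial `(a₁, …, aₘ; q)_n`. -/
def qShiftMulti {m : ℕ} (q : ℂ) (a : Fin m → ℂ) (n : ℕ) : ℂ := ∏ i, qShift q (a i) n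

/-- The multiple `q`-shifted factorial `(a₁, …, aₘ; q)_∞`. -/
def qShiftMultiInf {m : ℕ} (q : ℂ) (a : Fin m → ℂ) : ℂ := ∏ i, qShiftInf q (a i)

/-- The `n`-th term of the basic hypergeometric series
`_{r+1}φ_r(a₁, …, a_{r+1}; b₁, …, b_r; q, z)`, namely
`(a₁, …, a_{r+1}; q)_n z^n / (q, b₁, …, b_r; q)_n`. -/
def basicPhiTerm {r : ℕ} (a : Fin (r + 1) → ℂ) (b : Fin r → ℂ) (q z : ℂ) (n : ℕ) : ℂ :=
  qShiftMulti q a n * z ^ n / qShiftMulti q (Matrix.vecCons q b) n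

/-- The basic hypergeometric series `_{r+1}φ_r(a₁, …, a_{r+1}; b₁, …, b_r; q, z)`. -/
def basicPhi {r : ℕ} (a : Fin (r + 1) → ℂ) (b : Fin r → ℂ) (q z : ℂ) : ℂ :=
  ∑' n : ℕ, basicPhiTerm a b q z n

/-- The numerator parameters `a₁, q √a₁, -q √a₁, a₄, …` of a very-well-poised series.
Here `√a₁` is the principal square root; the series depends only on `{√a₁, -√a₁}`. -/
def vwpNum {m : ℕ} (q a₁ : ℂ) (a : Fin m → ℂ) : Fin (m + 3) → ℂ :=
  Matrix.vecCons a₁ (Matrix.vecCons (q * a₁ ^ (1 / 2 : ℂ))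
    (Matrix.vecCons (-(q * a₁ ^ (1 / 2 : ℂ))) a))

/-- The denominator parameters `√a₁, -√a₁, q a₁ / a₄, …` of a very-well-poised series. -/
def vwpDen {m : ℕ} (q a₁ : ℂ) (a : Fin m → ℂ) : Fin (m + 2) → ℂ :=
  Matrix.vecCons (a₁ ^ (1 / 2 : ℂ))
    (Matrix.vecCons (-a₁ ^ (1 / 2 : ℂ)) (fun i => q * a₁ / a i))

/-- The `n`-th term of the very-well-poised series `_{r+1}W_r(a₁; a₄, …, a_{r+1}; q, z)`,
where `a` lists the `m = r - 2` parameters `a₄, …, a_{r+1}`. -/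
def veryWellPoisedTerm {m : ℕ} (a₁ : ℂ) (a : Fin m → ℂ) (q z : ℂ) (n : ℕ) : ℂ :=
  basicPhiTerm (vwpNum q a₁ a) (vwpDen q a₁ a) q z n

/-- The very-well-poised series `_{r+1}W_r(a₁; a₄, …, a_{r+1}; q, z)`,
where `a` lists the `m = r - 2` parameters `a₄, …, a_{r+1}`. -/
def veryWellPoised {m : ℕ} (a₁ : ℂ) (a : Fin m → ℂ) (q z : ℂ) : ℂ :=
  basicPhi (vwpNum q a₁ a) (vwpDen q a₁ a) q z

/-- `h(x; a | q) = ∏_{k≥0} (1 - 2 q^k a x + q^{2k} a²)`; for `x = cos θ` this is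
`(a e^{iθ}, a e^{-iθ}; q)_∞`. -/
def hProd (q : ℂ) (x : ℝ) (a : ℂ) : ℂ :=
  ∏' k : ℕ, (1 - 2 * q ^ k * a * (x : ℂ) + q ^ (2 * k) * a ^ 2)

/-- `h(x; a₁, …, aₘ | q) = h(x; a₁ | q) ⋯ h(x; aₘ | q)`. -/
def hMulti {m : ℕ} (q : ℂ) (x : ℝ) (a : Fin m → ℂ) : ℂ := ∏ i, hProd q x (a i)

/-- The integrand
`h(cos 2θ; 1 | q) h(cos θ; abcdrz | q) / h(cos θ; a, b, c, d, r | q)`. -/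
def alSalamIsmailIntegrand (q a b c d r z : ℂ) (θ : ℝ) : ℂ :=
  hProd q (Real.cos (2 * θ)) 1 * hProd q (Real.cos θ) (a * b * c * d * r * z) /
    hMulti q (Real.cos θ) ![a, b, c, d, r]

end

/-! Put `w = e^{iθ}`, `p = bcdr` and `f = abcdrz`. The integral is easy when it is balanced, that is
when `z = 1`, and the general integrand is a superposition of balanced ones.

Superposition: Rogers' very-well-poised `₆φ₅` sum with `u = aw`, `v = a/w` expands the quotient
`(fw, f/w)_∞ / (aw, a/w)_∞` in the quotients `(apq^k w, apq^k/w)_∞ / (aq^k w, aq^k/w)_∞`. The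
coefficients involve `u` and `v` only through `uv = a²`, so they do not depend on `θ`. Each term is
therefore the balanced integrand with `a` replaced by `aq^k` (`hasSum_wpCoeff_mul_rahmanKernel`),
and dominated convergence allows termwise integration. The `₆φ₅` sum itself comes from a first-order
`q`-difference equation in `z`, proved by telescoping. Iterating it towards `z = 0` determines the
sum up to a constant, and the constant is fixed at `z = 1`, where only the term `k = 0` survives.

Balanced case (Nassrallah–Rahman, `rahmanIntegral_eq`): a contiguous relation links `a` to `aq`. The
difference of the two integrands is a multiple of `G(w) + G(1/w)`, where `G(w/q) = -G(1/w)` and `G`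
is analytic on `1 ≤ |w| ≤ 1/q`; moving the contour shows that `∫ G = 0`. Iteration sends `a` to `0`,
and by symmetry all five parameters can be removed. The remaining constant is found from the
parameters `q, -q, √q, -√q, 0`, for which the integrand is a trigonometric polynomial.

The contiguous relation also gives the ratio of the balanced integrals at `aq^k` and at `a`, a
quotient of finite shifted factorials. Multiplied by the expansion coefficients, these ratios are
the terms of the `₈W₇` series. -/

open Filter Topology

/-! ### Shifted factorials: convergence, analyticity and uniform bounds -/

section QShift

variable {q : ℂ}

theorem qShift_succ (q a : ℂ) (n : ℕ) : qShift q a (n + 1) = qShift q a n * (1 - a * q ^ n) :=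
  Finset.prod_range_succ _ _

theorem qShift_zero_param (q : ℂ) (n : ℕ) : qShift q 0 n = 1 := by simp [qShift]

theorem qShift_add (q a : ℂ) (n m : ℕ) :
    qShift q a (n + m) = qShift q a n * qShift q (a * q ^ n) m := by
  simp only [qShift, Finset.prod_range_add]
  congr 1
  exact Finset.prod_congr rfl fun k _ => by rw [pow_add, mul_assoc]

theorem summable_norm_mul_pow (hq : ‖q‖ < 1) (a : ℂ) : Summable fun k : ℕ => ‖-(a * q ^ k)‖ := by
  simpa using (summable_geometric_of_lt_one (norm_nonneg q) hq).mul_left ‖a‖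

theorem multipliable_one_sub_mul_pow (hq : ‖q‖ < 1) (a : ℂ) :
    Multipliable fun k : ℕ => 1 - a * q ^ k := by
  simpa [sub_eq_add_neg] using multipliable_one_add_of_summable (summable_norm_mul_pow hq a)

theorem tendsto_qShift (hq : ‖q‖ < 1) (a : ℂ) :
    Tendsto (qShift q a) atTop (𝓝 (qShiftInf q a)) :=
  (multipliable_one_sub_mul_pow hq a).tendsto_prod_tprod_nat

theorem qShiftInf_eq_mul (hq : ‖q‖ < 1) (a : ℂ) (n : ℕ) :
    qShiftInf q a = qShift q a n * qShiftInf q (a * q ^ n) := by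
  have h1 : Tendsto (fun m => qShift q a (n + m)) atTop (𝓝 (qShiftInf q a)) := by
    simpa [add_comm] using (tendsto_add_atTop_iff_nat n).2 (tendsto_qShift hq a)
  simp only [qShift_add] at h1
  exact tendsto_nhds_unique h1 ((tendsto_qShift hq _).const_mul _)

theorem qShiftInf_eq_one_sub_mul (hq : ‖q‖ < 1) (a : ℂ) :
    qShiftInf q a = (1 - a) * qShiftInf q (a * q) := by
  simpa [qShift] using qShiftInf_eq_mul hq a 1

theorem qShiftInf_zero (q : ℂ) : qShiftInf q 0 = 1 := by simp [qShiftInf]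

theorem one_sub_ne_zero_of_norm_lt {w : ℂ} (hw : ‖w‖ < 1) : 1 - w ≠ 0 := by
  intro h
  rw [sub_eq_zero] at h
  simp [← h] at hw

theorem norm_mul_pow_lt (hq : ‖q‖ < 1) {a : ℂ} (ha : ‖a‖ < 1) (k : ℕ) : ‖a * q ^ k‖ < 1 := by
  rw [norm_mul, norm_pow]
  exact (mul_le_of_le_one_right (norm_nonneg _) (pow_le_one₀ (norm_nonneg _) hq.le)).trans_lt ha

theorem qShift_ne_zero (hq : ‖q‖ < 1) {a : ℂ} (ha : ‖a‖ < 1) (n : ℕ) : qShift q a n ≠ 0 :=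
  Finset.prod_ne_zero_iff.2 fun k _ => one_sub_ne_zero_of_norm_lt (norm_mul_pow_lt hq ha k)

theorem qShiftInf_ne_zero (hq : ‖q‖ < 1) {a : ℂ} (ha : ‖a‖ < 1) : qShiftInf q a ≠ 0 := by
  have h := tprod_one_add_ne_zero_of_summable (f := fun k : ℕ => -(a * q ^ k))
    (fun k => by
      simpa [sub_eq_add_neg] using one_sub_ne_zero_of_norm_lt (norm_mul_pow_lt hq ha k))
    (summable_norm_mul_pow hq a)
  simpa [qShiftInf, sub_eq_add_neg] using h

theorem differentiable_qShiftInf (hq : ‖q‖ < 1) : Differentiable ℂ (qShiftInf q) := by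
  intro w
  have hloc : HasProdLocallyUniformlyOn (fun (k : ℕ) (a : ℂ) => 1 + -(a * q ^ k))
      (fun a => ∏' k : ℕ, (1 + -(a * q ^ k))) (Metric.ball 0 (‖w‖ + 1)) := by
    refine Summable.hasProdLocallyUniformlyOn_nat_one_add (u := fun k => (‖w‖ + 1) * ‖q‖ ^ k)
      Metric.isOpen_ball
      ((summable_geometric_of_lt_one (norm_nonneg q) hq).mul_left _) ?_ ?_
    · refine Eventually.of_forall fun k a ha => ?_
      rw [norm_neg, norm_mul, norm_pow]
      have : ‖a‖ < ‖w‖ + 1 := by simpa using ha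
      gcongr
    · intro k; fun_prop
  have hd : DifferentiableOn ℂ (fun a => ∏' k : ℕ, (1 + -(a * q ^ k)))
      (Metric.ball 0 (‖w‖ + 1)) := by
    refine hloc.differentiableOn ?_ Metric.isOpen_ball
    refine Eventually.of_forall fun s => ?_
    fun_prop
  have := hd.differentiableAt (Metric.isOpen_ball.mem_nhds (x := w) (by simp))
  have heq : qShiftInf q = fun a => ∏' k : ℕ, (1 + -(a * q ^ k)) := by
    funext a; simp [qShiftInf, sub_eq_add_neg]
  rwa [heq]

theorem continuous_qShiftInf (hq : ‖q‖ < 1) : Continuous (qShiftInf q) :=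
  (differentiable_qShiftInf hq).continuous

theorem exists_norm_qShiftInf_le (hq : ‖q‖ < 1) (R : ℝ) :
    ∃ C, 0 < C ∧ ∀ w : ℂ, ‖w‖ ≤ R → ‖qShiftInf q w‖ ≤ C := by
  obtain ⟨C, hC⟩ := (isCompact_closedBall (0 : ℂ) R).exists_bound_of_continuousOn
    (continuous_qShiftInf hq).continuousOn
  exact ⟨max C 1, by simp, fun w hw => (hC w (by simpa using hw)).trans (le_max_left _ _)⟩

theorem exists_norm_inv_qShiftInf_le (hq : ‖q‖ < 1) {R : ℝ} (hR : R < 1) :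
    ∃ C, 0 < C ∧ ∀ w : ℂ, ‖w‖ ≤ R → ‖(qShiftInf q w)⁻¹‖ ≤ C := by
  obtain ⟨C, hC⟩ := (isCompact_closedBall (0 : ℂ) R).exists_bound_of_continuousOn
    (f := fun w => (qShiftInf q w)⁻¹)
    ((continuous_qShiftInf hq).continuousOn.inv₀ fun w hw =>
      qShiftInf_ne_zero hq ((by simpa using hw : ‖w‖ ≤ R).trans_lt hR))
  exact ⟨max C 1, by simp, fun w hw => (hC w (by simpa using hw)).trans (le_max_left _ _)⟩

/-- The shifted factorials `(a; q)_n` are bounded in `n`. -/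
theorem exists_norm_qShift_le (hq : ‖q‖ < 1) (a : ℂ) :
    ∃ C, 0 < C ∧ ∀ n, ‖qShift q a n‖ ≤ C := by
  obtain ⟨C, hC⟩ := (tendsto_qShift hq a).norm.bddAbove_range
  exact ⟨max C 1, by simp, fun n => (hC ⟨n, rfl⟩).trans (le_max_left _ _)⟩

/-- Turns bounds for the infinite product on compact sets into bounds for `1/(a; q)_n` that are
uniform in both `a` and `n`. -/
theorem qShift_inv_eq (hq : ‖q‖ < 1) {a : ℂ} (ha : ‖a‖ < 1) (n : ℕ) :
    (qShift q a n)⁻¹ = qShiftInf q (a * q ^ n) * (qShiftInf q a)⁻¹ := by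
  have h1 := qShiftInf_eq_mul hq a n
  have h2 := qShiftInf_ne_zero hq ha
  have h3 := qShift_ne_zero hq ha n
  field_simp
  rw [h1, mul_comm]

theorem exists_norm_inv_qShift_le (hq : ‖q‖ < 1) {R : ℝ} (hR : R < 1) :
    ∃ C, 0 < C ∧ ∀ a : ℂ, ‖a‖ ≤ R → ∀ n, ‖(qShift q a n)⁻¹‖ ≤ C := by
  obtain ⟨C, hC0, hC⟩ := exists_norm_qShiftInf_le hq 1
  obtain ⟨D, hD0, hD⟩ := exists_norm_inv_qShiftInf_le hq hR
  refine ⟨C * D, mul_pos hC0 hD0, fun a ha n => ?_⟩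
  rw [qShift_inv_eq hq (ha.trans_lt hR), norm_mul]
  exact mul_le_mul (hC _ (norm_mul_pow_lt hq (ha.trans_lt hR) n).le) (hD a ha)
    (norm_nonneg _) hC0.le

theorem tendsto_qShiftInf_mul_pow (hq : ‖q‖ < 1) (a : ℂ) :
    Tendsto (fun n : ℕ => qShiftInf q (a * q ^ n)) atTop (𝓝 1) := by
  have h : Tendsto (fun n : ℕ => a * q ^ n) atTop (𝓝 0) := by
    simpa using (tendsto_pow_atTop_nhds_zero_of_norm_lt_one hq).const_mul a
  simpa [qShiftInf_zero, Function.comp_def] using ((continuous_qShiftInf hq).tendsto 0).comp h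

/-- `(w, -w, sw, -sw; s²)_∞ = (w²; s²)_∞`. -/
theorem qShiftInf_quadruple {s : ℂ} (hs : ‖s‖ < 1) (w : ℂ) :
    qShiftInf (s ^ 2) w * qShiftInf (s ^ 2) (-w) * qShiftInf (s ^ 2) (s * w) *
      qShiftInf (s ^ 2) (-(s * w)) = qShiftInf (s ^ 2) (w ^ 2) := by
  have hq : ‖s ^ 2‖ < 1 := by
    rw [norm_pow]; exact pow_lt_one₀ (norm_nonneg _) hs two_ne_zero
  -- With base `s²`, the pair `±w` contributes the even-indexed factors of `(w²; s²)_{2n}` and the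
  -- pair `±sw` the odd-indexed ones.
  have hfin : ∀ n, qShift (s ^ 2) w n * qShift (s ^ 2) (-w) n * qShift (s ^ 2) (s * w) n *
      qShift (s ^ 2) (-(s * w)) n = qShift (s ^ 2) (w ^ 2) (2 * n) := by
    intro n
    induction n with
    | zero => simp [qShift]
    | succ n ih =>
      rw [show 2 * (n + 1) = 2 * n + 1 + 1 by ring]
      simp only [qShift_succ]
      rw [← ih]
      ring
  have h1 := (((tendsto_qShift hq w).mul (tendsto_qShift hq (-w))).mul
    (tendsto_qShift hq (s * w))).mul (tendsto_qShift hq (-(s * w)))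
  have h2 : Tendsto (fun n => qShift (s ^ 2) (w ^ 2) (2 * n)) atTop
      (𝓝 (qShiftInf (s ^ 2) (w ^ 2))) :=
    (tendsto_qShift hq _).comp (tendsto_id.const_mul_atTop' (by norm_num))
  refine tendsto_nhds_unique h1 ?_
  simpa only [hfin] using h2

end QShift

/-! ### Rogers' nonterminating `₆φ₅` sum -/

section SixPhiFive

variable {q : ℂ}

theorem prod_mul_sub_pow (q z : ℂ) (n : ℕ) :
    ∏ j ∈ Finset.range (n + 1), (z * q - q ^ j) =
      q ^ n * (z * q - 1) * ∏ j ∈ Finset.range n, (z - q ^ j) := by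
  rw [Finset.prod_range_succ']
  have h : ∀ j ∈ Finset.range n, z * q - q ^ (j + 1) = q * (z - q ^ j) := fun j _ => by ring
  rw [Finset.prod_congr rfl h, Finset.prod_mul_distrib]
  simp
  ring

/-- The coefficient `(B/q)_k (1 - B q^{2k-1}) (1/z)_k (pz)^k / ((1 - B/q) (q)_k (Bz)_k)` of a
very-well-poised series, written without denominators that may vanish. -/
noncomputable def wpCoeff (q B p z : ℂ) : ℕ → ℂ
  | 0 => 1
  | k + 1 => qShift q B k * (1 - B * q ^ (2 * k + 1)) *
      (p ^ (k + 1) * ∏ j ∈ Finset.range (k + 1), (z - q ^ j)) /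
      (qShift q q (k + 1) * qShift q (B * z) (k + 1))

/-- The general term of the very-well-poised `₆φ₅` series with numerator parameters `u`, `v`. -/
noncomputable def sixPhiTerm (q p u v z : ℂ) (k : ℕ) : ℂ :=
  wpCoeff q (u * v * p) p z k * (qShift q u k * qShift q v k) /
    (qShift q (p * u) k * qShift q (p * v) k)

theorem norm_mul_lt_one {x y : ℂ} (hx : ‖x‖ < 1) (hy : ‖y‖ < 1) : ‖x * y‖ < 1 := by
  rw [norm_mul]
  exact mul_lt_one_of_nonneg_of_lt_one_left (norm_nonneg _) hx hy.le

/-- Telescoping certificate for the `q`-difference equation in `z`: the right side is the boundary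
term, and it vanishes as `n → ∞` because `p^n ∏ (z - q^j)` is `O(|pz|^n)`. -/
theorem sum_range_sixPhiTerm_sub (hq : ‖q‖ < 1) {p u v z : ℂ} (hp : ‖p‖ < 1) (hu : ‖u‖ < 1)
    (hv : ‖v‖ < 1) (hpz : ‖p * z‖ < 1) (n : ℕ) :
    ∑ k ∈ Finset.range (n + 1), ((1 - u * v * p * z) * (1 - p * z) * sixPhiTerm q p u v z k -
        (1 - p * u * z) * (1 - p * v * z) * sixPhiTerm q p u v (z * q) k) =
      -z * (p ^ (n + 1) * ∏ j ∈ Finset.range n, (z - q ^ j)) *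
        (qShift q (u * v * p) n * (qShift q u (n + 1) * qShift q v (n + 1))) /
        (qShift q q n * qShift q (u * v * p * z * q) n *
          (qShift q (p * u) n * qShift q (p * v) n)) := by
  have huv := norm_mul_lt_one hu hv
  have hB : ‖u * v * p * z‖ < 1 := by
    rw [mul_assoc (u * v)]; exact norm_mul_lt_one huv hpz
  induction n with
  | zero => simp [sixPhiTerm, wpCoeff, qShift]; ring
  | succ n ih =>
    rw [Finset.sum_range_succ, ih]
    have e1 : qShift q (u * v * p * z) (n + 1) =
        (1 - u * v * p * z) * qShift q (u * v * p * z * q) n := by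
      rw [add_comm, qShift_add]; simp [qShift]
    have e2 : u * v * p * (z * q) = u * v * p * z * q := by ring
    simp only [sixPhiTerm, wpCoeff, prod_mul_sub_pow, e1, e2]
    have n1 := qShift_ne_zero hq hq n
    have n2 := qShift_ne_zero hq (norm_mul_lt_one hB hq) n
    have n3 := qShift_ne_zero hq (norm_mul_lt_one hp hu) n
    have n4 := qShift_ne_zero hq (norm_mul_lt_one hp hv) n
    have m1 := one_sub_ne_zero_of_norm_lt (norm_mul_pow_lt hq hq n)
    have m2 := one_sub_ne_zero_of_norm_lt (norm_mul_pow_lt hq (norm_mul_lt_one hB hq) n)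
    have m3 := one_sub_ne_zero_of_norm_lt (norm_mul_pow_lt hq (norm_mul_lt_one hp hu) n)
    have m4 := one_sub_ne_zero_of_norm_lt (norm_mul_pow_lt hq (norm_mul_lt_one hp hv) n)
    have m5 := one_sub_ne_zero_of_norm_lt hB
    simp only [qShift_succ, Finset.prod_range_succ, pow_succ, pow_mul']
    generalize qShift q q n = Q0 at *
    generalize qShift q (u * v * p * z * q) n = X at *
    generalize qShift q (p * u) n = U1 at *
    generalize qShift q (p * v) n = V1 at *
    generalize qShift q u n = U at *
    generalize qShift q v n = V at *
    generalize qShift q (u * v * p) n = B0 at *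
    generalize ∏ j ∈ Finset.range n, (z - q ^ j) = Z at *
    generalize p ^ n = P at *
    generalize q ^ n = t at *
    -- The denominators stay opaque while fractions are cleared, and are restored for the final
    -- polynomial identity.
    generalize hd1 : 1 - q * t = d1 at *
    generalize hd2 : 1 - u * v * p * z * q * t = d2 at *
    generalize hd3 : 1 - p * u * t = d3 at *
    generalize hd4 : 1 - p * v * t = d4 at *
    generalize hd5 : 1 - u * v * p * z = d5 at *
    field_simp
    subst hd1 hd2 hd3 hd4 hd5
    ring

/-- Uniformity over `‖w‖ ≤ ‖z‖` covers the whole orbit `z q^n`, as needed for dominated convergence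
when `n → ∞`. -/
theorem exists_norm_wpCoeff_le (hq : ‖q‖ < 1) (p : ℂ) {B z : ℂ} (hB : ‖B * z‖ < 1) :
    ∃ C, 0 < C ∧ ∀ w : ℂ, ‖w‖ ≤ ‖z‖ → ∀ k,
      ‖wpCoeff q B p w k‖ ≤ C * ‖p ^ k * ∏ j ∈ Finset.range k, (w - q ^ j)‖ := by
  obtain ⟨C1, h1, H1⟩ := exists_norm_qShift_le hq B
  obtain ⟨C2, h2, H2⟩ := exists_norm_inv_qShift_le hq hB
  obtain ⟨C3, h3, H3⟩ := exists_norm_inv_qShift_le hq hq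
  refine ⟨max 1 (C1 * (1 + ‖B‖) * (C3 * C2)), by positivity, fun w hw k => ?_⟩
  cases k with
  | zero => simp [wpCoeff]
  | succ k =>
    have hfac : ‖1 - B * q ^ (2 * k + 1)‖ ≤ 1 + ‖B‖ := by
      refine (norm_sub_le _ _).trans ?_
      rw [norm_one, norm_mul, norm_pow]
      gcongr
      exact mul_le_of_le_one_right (norm_nonneg _) (pow_le_one₀ (norm_nonneg _) hq.le)
    have hw' : ‖B * w‖ ≤ ‖B * z‖ := by
      rw [norm_mul, norm_mul]; gcongr
    rw [wpCoeff, div_eq_mul_inv, mul_inv, norm_mul, norm_mul _ (_ * ∏ j ∈ _, _), norm_mul,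
      norm_mul (qShift q q _)⁻¹]
    calc _ ≤ C1 * (1 + ‖B‖) * ‖p ^ (k + 1) * ∏ j ∈ Finset.range (k + 1), (w - q ^ j)‖ *
          (C3 * C2) := by
            gcongr
            · exact H1 k
            · exact H3 q le_rfl _
            · exact H2 _ hw' _
      _ = C1 * (1 + ‖B‖) * (C3 * C2) *
          ‖p ^ (k + 1) * ∏ j ∈ Finset.range (k + 1), (w - q ^ j)‖ := by ring
      _ ≤ _ := by gcongr; exact le_max_right _ _

/-- For `|w| ≤ 1` the products `∏ (w - q^j)` are bounded uniformly. -/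
theorem exists_norm_prod_sub_pow_le (hq : ‖q‖ < 1) :
    ∃ C, 0 < C ∧ ∀ w : ℂ, ‖w‖ ≤ 1 → ∀ k, ‖∏ j ∈ Finset.range k, (w - q ^ j)‖ ≤ C := by
  -- The majorant is `∏ (1 + |q|^j) = (-1; |q|)_k`.
  obtain ⟨C, h, H⟩ := exists_norm_qShift_le (q := (‖q‖ : ℂ)) (by simpa using hq) (-1)
  refine ⟨C, h, fun w hw k => ?_⟩
  refine le_trans ?_ (H k)
  rw [norm_prod, qShift, norm_prod]
  refine Finset.prod_le_prod (fun _ _ => norm_nonneg _) fun j _ => ?_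
  refine (norm_sub_le _ _).trans ?_
  have : (1 - -1 * (‖q‖ : ℂ) ^ j) = ((1 + ‖q‖ ^ j : ℝ) : ℂ) := by push_cast; ring
  rw [this, Complex.norm_of_nonneg (by positivity), norm_pow]
  gcongr

theorem prod_sub_pow_eq_qShift (q p : ℂ) {z : ℂ} (hz : z ≠ 0) (k : ℕ) :
    p ^ k * ∏ j ∈ Finset.range k, (z - q ^ j) = qShift q (1 / z) k * (p * z) ^ k := by
  rw [qShift, mul_pow, mul_left_comm, ← Finset.card_range k, ← Finset.prod_const (b := z),
    Finset.card_range, ← Finset.prod_mul_distrib]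
  congr 1
  refine Finset.prod_congr rfl fun j _ => ?_
  field_simp

/-- For `z ≠ 0` the products `p^k ∏ (z - q^j)` are `O(|pz|^k)`. -/
theorem exists_norm_pow_mul_prod_sub_pow_le (hq : ‖q‖ < 1) (p : ℂ) {z : ℂ} (hz : z ≠ 0) :
    ∃ C, 0 < C ∧ ∀ k, ‖p ^ k * ∏ j ∈ Finset.range k, (z - q ^ j)‖ ≤ C * ‖p * z‖ ^ k := by
  obtain ⟨C, h, H⟩ := exists_norm_qShift_le hq (1 / z)
  refine ⟨C, h, fun k => ?_⟩
  rw [prod_sub_pow_eq_qShift q p hz, norm_mul, norm_pow]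
  gcongr
  exact H k

theorem exists_norm_sixPhiTerm_le (hq : ‖q‖ < 1) {p u v z : ℂ} (hp : ‖p‖ < 1) (hu : ‖u‖ < 1)
    (hv : ‖v‖ < 1) (hpz : ‖p * z‖ < 1) :
    ∃ C, 0 < C ∧ ∀ w : ℂ, ‖w‖ ≤ ‖z‖ → ∀ k,
      ‖sixPhiTerm q p u v w k‖ ≤ C * ‖p ^ k * ∏ j ∈ Finset.range k, (w - q ^ j)‖ := by
  have huv := norm_mul_lt_one hu hv
  have hB : ‖u * v * p * z‖ < 1 := by
    rw [mul_assoc (u * v)]; exact norm_mul_lt_one huv hpz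
  obtain ⟨C0, h0, H0⟩ := exists_norm_wpCoeff_le hq p hB
  obtain ⟨C1, h1, H1⟩ := exists_norm_qShift_le hq u
  obtain ⟨C2, h2, H2⟩ := exists_norm_qShift_le hq v
  obtain ⟨C3, h3, H3⟩ := exists_norm_inv_qShift_le hq (norm_mul_lt_one hp hu)
  obtain ⟨C4, h4, H4⟩ := exists_norm_inv_qShift_le hq (norm_mul_lt_one hp hv)
  refine ⟨C0 * (C1 * C2) * (C3 * C4), by positivity, fun w hw k => ?_⟩
  rw [sixPhiTerm, div_eq_mul_inv, mul_inv, norm_mul, norm_mul, norm_mul, norm_mul]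
  calc _ ≤ C0 * ‖p ^ k * ∏ j ∈ Finset.range k, (w - q ^ j)‖ * (C1 * C2) * (C3 * C4) := by
        gcongr
        · exact H0 w hw k
        · exact H1 k
        · exact H2 k
        · exact H3 _ le_rfl k
        · exact H4 _ le_rfl k
    _ = _ := by ring

theorem summable_sixPhiTerm (hq : ‖q‖ < 1) {p u v z : ℂ} (hp : ‖p‖ < 1) (hu : ‖u‖ < 1)
    (hv : ‖v‖ < 1) (hpz : ‖p * z‖ < 1) (hz : z ≠ 0) : Summable (sixPhiTerm q p u v z) := by
  obtain ⟨C, h, H⟩ := exists_norm_sixPhiTerm_le hq hp hu hv hpz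
  obtain ⟨D, h', H'⟩ := exists_norm_pow_mul_prod_sub_pow_le hq p hz
  refine Summable.of_norm_bounded
    (((summable_geometric_of_lt_one (norm_nonneg _) hpz).mul_left D).mul_left C) fun k => ?_
  exact (H z le_rfl k).trans (mul_le_mul_of_nonneg_left (H' k) h.le)

/-- The limit of the telescoped partial sums. -/
theorem tsum_sixPhiTerm_mul (hq : ‖q‖ < 1) (hq0 : q ≠ 0) {p u v z : ℂ} (hp : ‖p‖ < 1)
    (hu : ‖u‖ < 1) (hv : ‖v‖ < 1) (hpz : ‖p * z‖ < 1) (hz : z ≠ 0) :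
    (1 - u * v * p * z) * (1 - p * z) * ∑' k, sixPhiTerm q p u v z k =
      (1 - p * u * z) * (1 - p * v * z) * ∑' k, sixPhiTerm q p u v (z * q) k := by
  have hpzq : ‖p * (z * q)‖ < 1 := by rw [← mul_assoc]; exact norm_mul_lt_one hpz hq
  have s1 := (summable_sixPhiTerm hq hp hu hv hpz hz).hasSum.mul_left
    ((1 - u * v * p * z) * (1 - p * z))
  have s2 := (summable_sixPhiTerm hq hp hu hv hpzq (mul_ne_zero hz hq0)).hasSum.mul_left
    ((1 - p * u * z) * (1 - p * v * z))
  have s3 := ((tendsto_add_atTop_iff_nat 1).2 (s1.sub s2).tendsto_sum_nat)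
  simp only [sum_range_sixPhiTerm_sub hq hp hu hv hpz] at s3
  refine sub_eq_zero.1 (tendsto_nhds_unique s3 ?_)
  have huv := norm_mul_lt_one hu hv
  have hB : ‖u * v * p * z‖ < 1 := by
    rw [mul_assoc (u * v)]; exact norm_mul_lt_one huv hpz
  have hlim : Tendsto (fun n => qShift q (u * v * p) n *
      (qShift q u (n + 1) * qShift q v (n + 1)) /
        (qShift q q n * qShift q (u * v * p * z * q) n *
          (qShift q (p * u) n * qShift q (p * v) n))) atTop (𝓝 (qShiftInf q (u * v * p) *
      (qShiftInf q u * qShiftInf q v) /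
        (qShiftInf q q * qShiftInf q (u * v * p * z * q) *
          (qShiftInf q (p * u) * qShiftInf q (p * v))))) := by
    refine Tendsto.div ((tendsto_qShift hq _).mul
      (((tendsto_add_atTop_iff_nat 1).2 (tendsto_qShift hq u)).mul
        ((tendsto_add_atTop_iff_nat 1).2 (tendsto_qShift hq v))))
      (((tendsto_qShift hq _).mul (tendsto_qShift hq _)).mul
        ((tendsto_qShift hq _).mul (tendsto_qShift hq _))) ?_
    exact mul_ne_zero (mul_ne_zero (qShiftInf_ne_zero hq hq)
      (qShiftInf_ne_zero hq (norm_mul_lt_one hB hq)))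
      (mul_ne_zero (qShiftInf_ne_zero hq (norm_mul_lt_one hp hu))
        (qShiftInf_ne_zero hq (norm_mul_lt_one hp hv)))
  have hz0 : Tendsto (fun n => -z * (p ^ (n + 1) * ∏ j ∈ Finset.range n, (z - q ^ j))) atTop
      (𝓝 0) := by
    obtain ⟨D, h', H'⟩ := exists_norm_pow_mul_prod_sub_pow_le hq p hz
    have h0 : Tendsto (fun n => p ^ n * ∏ j ∈ Finset.range n, (z - q ^ j)) atTop (𝓝 0) := by
      refine squeeze_zero_norm H' ?_
      simpa using (tendsto_pow_atTop_nhds_zero_of_lt_one (norm_nonneg _) hpz).const_mul D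
    have := h0.const_mul (-z * p)
    rw [mul_zero] at this
    refine this.congr fun n => ?_
    ring
  have := hz0.mul hlim
  rw [zero_mul] at this
  refine this.congr fun n => ?_
  exact (mul_div_assoc _ _ _).symm

/-- Iterates the `q`-difference equation along `z, zq, zq², …` down to `0`. The value `z = 0` is
admissible because `wpCoeff` contains the polynomial `∏ (z - q^j)` in place of `(1/z)_k z^k`. -/
theorem qShiftInf_mul_tsum_sixPhiTerm (hq : ‖q‖ < 1) (hq0 : q ≠ 0) {p u v z : ℂ} (hp : ‖p‖ < 1)
    (hu : ‖u‖ < 1) (hv : ‖v‖ < 1) (hpz : ‖p * z‖ < 1) (hz : z ≠ 0) :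
    qShiftInf q (u * v * p * z) * qShiftInf q (p * z) * ∑' k, sixPhiTerm q p u v z k =
      qShiftInf q (p * u * z) * qShiftInf q (p * v * z) * ∑' k, sixPhiTerm q p u v 0 k := by
  have hpzn : ∀ n : ℕ, ‖p * (z * q ^ n)‖ < 1 := fun n => by
    rw [← mul_assoc]; exact norm_mul_pow_lt hq hpz n
  have hzn : ∀ n : ℕ, z * q ^ n ≠ 0 := fun n => mul_ne_zero hz (pow_ne_zero _ hq0)
  have hstep : ∀ n : ℕ,
      qShiftInf q (u * v * p * z) * qShiftInf q (p * z) * ∑' k, sixPhiTerm q p u v z k =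
      qShift q (p * u * z) n * qShift q (p * v * z) n *
        (qShiftInf q (u * v * p * z * q ^ n) * qShiftInf q (p * z * q ^ n) *
          ∑' k, sixPhiTerm q p u v (z * q ^ n) k) := by
    intro n
    induction n with
    | zero => simp [qShift]
    | succ n ih =>
      rw [ih]
      have h := tsum_sixPhiTerm_mul hq hq0 hp hu hv (hpzn n) (hzn n)
      rw [qShiftInf_eq_one_sub_mul hq (u * v * p * z * q ^ n),
        qShiftInf_eq_one_sub_mul hq (p * z * q ^ n)]
      simp only [qShift_succ, pow_succ, ← mul_assoc] at h ⊢
      linear_combination (qShift q (p * u * z) n * qShift q (p * v * z) n *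
        qShiftInf q (u * v * p * z * q ^ n * q) * qShiftInf q (p * z * q ^ n * q)) * h
  have hT : Tendsto (fun n : ℕ => ∑' k, sixPhiTerm q p u v (z * q ^ n) k) atTop
      (𝓝 (∑' k, sixPhiTerm q p u v 0 k)) := by
    obtain ⟨C, h, H⟩ := exists_norm_sixPhiTerm_le hq hp hu hv hpz
    obtain ⟨D, h', H'⟩ := exists_norm_prod_sub_pow_le hq
    have hzq : Tendsto (fun n : ℕ => z * q ^ n) atTop (𝓝 0) := by
      simpa using (tendsto_pow_atTop_nhds_zero_of_norm_lt_one hq).const_mul z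
    -- Once `|z q^n| < 1` the products `∏ (z q^n - q^j)` are bounded, so `|p| < 1` alone gives a
    -- summable majorant.
    refine tendsto_tsum_of_dominated_convergence (bound := fun k => C * (‖p‖ ^ k * D))
      (((summable_geometric_of_lt_one (norm_nonneg _) hp).mul_right D).mul_left C) ?_ ?_
    · intro k
      have hc : ContinuousAt (fun w => sixPhiTerm q p u v w k) 0 := by
        cases k with
        | zero => simp only [sixPhiTerm, wpCoeff]; fun_prop
        | succ k =>
          have n1 := qShift_ne_zero hq hq (k + 1)
          simp only [sixPhiTerm, wpCoeff]
          refine ContinuousAt.div_const (ContinuousAt.mul (ContinuousAt.div (by fun_prop) ?_ ?_)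
            continuousAt_const) _
          · simp only [qShift]; fun_prop
          · simpa [qShift_zero_param] using n1
      exact hc.tendsto.comp hzq
    · have hev : ∀ᶠ n : ℕ in atTop, ‖z * q ^ n‖ < 1 := by
        have := hzq.norm
        rw [norm_zero] at this
        exact this.eventually_lt_const one_pos
      filter_upwards [hev] with n hn k
      refine (H _ ?_ k).trans ?_
      · rw [norm_mul, norm_pow]
        exact mul_le_of_le_one_right (norm_nonneg _) (pow_le_one₀ (norm_nonneg _) hq.le)
      · rw [norm_mul, norm_pow]
        gcongr
        exact H' _ hn.le k
  have hlim := ((tendsto_qShift hq (p * u * z)).mul (tendsto_qShift hq (p * v * z))).mul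
    (((tendsto_qShiftInf_mul_pow hq (u * v * p * z)).mul
      (tendsto_qShiftInf_mul_pow hq (p * z))).mul hT)
  rw [one_mul, one_mul] at hlim
  exact tendsto_nhds_unique (tendsto_const_nhds.congr hstep) hlim

/-- Rogers' nonterminating very-well-poised `₆φ₅` sum. -/
theorem hasSum_sixPhiTerm (hq : ‖q‖ < 1) (hq0 : q ≠ 0) {p u v z : ℂ} (hp : ‖p‖ < 1)
    (hu : ‖u‖ < 1) (hv : ‖v‖ < 1) (hpz : ‖p * z‖ < 1) (hz : z ≠ 0) :
    HasSum (sixPhiTerm q p u v z)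
      (qShiftInf q (u * v * p) * qShiftInf q p * qShiftInf q (p * u * z) *
        qShiftInf q (p * v * z) / (qShiftInf q (u * v * p * z) * qShiftInf q (p * z) *
          qShiftInf q (p * u) * qShiftInf q (p * v))) := by
  have h1 := qShiftInf_mul_tsum_sixPhiTerm hq hq0 hp hu hv (z := 1) (by simpa using hp) one_ne_zero
  -- At `z = 1` the factor `j = 0` of `∏ (z - q^j)` kills every term with `k ≥ 1`; this evaluates
  -- the unknown sum at `z = 0`.
  have hone : ∑' k, sixPhiTerm q p u v 1 k = 1 := by
    rw [tsum_eq_single 0]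
    · simp [sixPhiTerm, wpCoeff, qShift]
    · intro k hk
      obtain ⟨k, rfl⟩ := Nat.exists_eq_succ_of_ne_zero hk
      have : ∏ j ∈ Finset.range (k + 1), ((1 : ℂ) - q ^ j) = 0 :=
        Finset.prod_eq_zero (Finset.mem_range.2 k.succ_pos) (by simp)
      simp [sixPhiTerm, wpCoeff, this]
  have hz' := qShiftInf_mul_tsum_sixPhiTerm hq hq0 hp hu hv hpz hz
  have huv := norm_mul_lt_one hu hv
  have hB : ‖u * v * p * z‖ < 1 := by
    rw [mul_assoc (u * v)]; exact norm_mul_lt_one huv hpz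
  have n1 := qShiftInf_ne_zero hq hB
  have n2 := qShiftInf_ne_zero hq hpz
  have n3 := qShiftInf_ne_zero hq (norm_mul_lt_one hp hu)
  have n4 := qShiftInf_ne_zero hq (norm_mul_lt_one hp hv)
  simp only [hone, mul_one] at h1
  convert (summable_sixPhiTerm hq hp hu hv hpz hz).hasSum using 1
  rw [div_eq_iff (by simp [*])]
  linear_combination (qShiftInf q (p * u * z) * qShiftInf q (p * v * z)) * h1 -
    (qShiftInf q (p * u) * qShiftInf q (p * v)) * hz'

theorem HasSum.trans_eq {f : ℕ → ℂ} {a b : ℂ} (h : HasSum f a) (hab : a = b) : HasSum f b :=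
  hab ▸ h

/-- The `₆φ₅` sum as an expansion of a quotient of infinite products. -/
theorem hasSum_wpCoeff_mul (hq : ‖q‖ < 1) (hq0 : q ≠ 0) {p u v z : ℂ} (hp : ‖p‖ < 1)
    (hu : ‖u‖ < 1) (hv : ‖v‖ < 1) (hpz : ‖p * z‖ < 1) (hz : z ≠ 0) :
    HasSum (fun k => wpCoeff q (u * v * p) p z k *
        (qShiftInf q (p * u * q ^ k) * qShiftInf q (p * v * q ^ k) /
          (qShiftInf q (u * q ^ k) * qShiftInf q (v * q ^ k))))
      (qShiftInf q (u * v * p) * qShiftInf q p / (qShiftInf q (u * v * p * z) *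
        qShiftInf q (p * z)) * (qShiftInf q (p * u * z) * qShiftInf q (p * v * z) /
          (qShiftInf q u * qShiftInf q v))) := by
  have hpu := norm_mul_lt_one hp hu
  have hpv := norm_mul_lt_one hp hv
  have n3 := qShiftInf_ne_zero hq hpu
  have n4 := qShiftInf_ne_zero hq hpv
  have n5 := qShiftInf_ne_zero hq hu
  have n6 := qShiftInf_ne_zero hq hv
  -- Since `(x)_∞ = (x)_k (x q^k)_∞`, this constant factor turns the finite factorials of each term
  -- into shifted infinite products.
  have h := (hasSum_sixPhiTerm hq hq0 hp hu hv hpz hz).mul_left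
    (qShiftInf q (p * u) * qShiftInf q (p * v) / (qShiftInf q u * qShiftInf q v))
  have hfun : ∀ k, wpCoeff q (u * v * p) p z k *
        (qShiftInf q (p * u * q ^ k) * qShiftInf q (p * v * q ^ k) /
          (qShiftInf q (u * q ^ k) * qShiftInf q (v * q ^ k))) =
      qShiftInf q (p * u) * qShiftInf q (p * v) / (qShiftInf q u * qShiftInf q v) *
        sixPhiTerm q p u v z k := by
    intro k
    have m1 := qShift_ne_zero hq hpu k
    have m2 := qShift_ne_zero hq hpv k
    have m3 := qShiftInf_ne_zero hq (norm_mul_pow_lt hq hu k)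
    have m4 := qShiftInf_ne_zero hq (norm_mul_pow_lt hq hv k)
    have m5 := qShift_ne_zero hq hu k
    have m6 := qShift_ne_zero hq hv k
    rw [sixPhiTerm, qShiftInf_eq_mul hq (p * u) k, qShiftInf_eq_mul hq (p * v) k,
      qShiftInf_eq_mul hq u k, qShiftInf_eq_mul hq v k]
    generalize qShift q (p * u) k = x1 at *
    generalize qShift q (p * v) k = x2 at *
    generalize qShift q u k = x3 at *
    generalize qShift q v k = x4 at *
    generalize qShiftInf q (u * q ^ k) = x5 at *
    generalize qShiftInf q (v * q ^ k) = x6 at *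
    field_simp
  simp only [hfun]
  refine h.trans_eq ?_
  have huv := norm_mul_lt_one hu hv
  have hB : ‖u * v * p * z‖ < 1 := by
    rw [mul_assoc (u * v)]; exact norm_mul_lt_one huv hpz
  have n1 := qShiftInf_ne_zero hq hB
  have n2 := qShiftInf_ne_zero hq hpz
  generalize qShiftInf q (p * u) = x1 at *
  generalize qShiftInf q (p * v) = x2 at *
  generalize qShiftInf q (p * z) = x3 at *
  generalize qShiftInf q (u * v * p * z) = x4 at *
  field_simp

end SixPhiFive

/-! ### The integrand on the unit circle and its contiguous relation -/

section AskeyKernel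

/-- `(a w, a / w; q)_∞`, which is `h(cos θ; a | q)` at `w = e^{iθ}`. -/
noncomputable def hPair (q w a : ℂ) : ℂ := qShiftInf q (a * w) * qShiftInf q (a * w⁻¹)

/-- `h(cos 2θ; 1) h(cos θ; f) / h(cos θ; a, b, c, d, r)` as a function of `w = e^{iθ}`. -/
noncomputable def rahmanKernel (q f a b c d r w : ℂ) : ℂ :=
  hPair q (w ^ 2) 1 * hPair q w f /
    (hPair q w a * hPair q w b * hPair q w c * hPair q w d * hPair q w r)

/-- The integral of the balanced kernel `f = abcdr` over a full period. -/
noncomputable def rahmanIntegral (q a b c d r : ℂ) : ℂ :=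
  ∫ θ in (0 : ℝ)..2 * Real.pi, rahmanKernel q (a * b * c * d * r) a b c d r (circleMap 0 1 θ)

theorem norm_circleMap_one (θ : ℝ) : ‖circleMap 0 1 θ‖ = 1 := by simp

theorem circleMap_one_ne_zero (θ : ℝ) : circleMap 0 1 θ ≠ 0 := by simp

theorem hPair_zero (q w : ℂ) : hPair q w 0 = 1 := by simp [hPair, qShiftInf_zero]

theorem hPair_inv (q w a : ℂ) : hPair q w⁻¹ a = hPair q w a := by
  simp [hPair, mul_comm]

variable {q : ℂ}

theorem hPair_ne_zero (hq : ‖q‖ < 1) {w a : ℂ} (hw : ‖w‖ = 1) (ha : ‖a‖ < 1) :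
    hPair q w a ≠ 0 :=
  mul_ne_zero (qShiftInf_ne_zero hq (by simpa [hw])) (qShiftInf_ne_zero hq (by simpa [hw]))

theorem continuous_inv_circleMap_one : Continuous fun θ => (circleMap 0 1 θ)⁻¹ :=
  (continuous_circleMap 0 1).inv₀ circleMap_one_ne_zero

theorem continuous_hPair {X : Type*} [TopologicalSpace X] (hq : ‖q‖ < 1) {a : X → ℂ} {t : X → ℝ}
    (ha : Continuous a) (ht : Continuous t) :
    Continuous fun x => hPair q (circleMap 0 1 (t x)) (a x) := by
  have h1 := (continuous_circleMap 0 1).comp ht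
  have h2 := continuous_inv_circleMap_one.comp ht
  exact ((continuous_qShiftInf hq).comp (ha.mul h1)).mul
    ((continuous_qShiftInf hq).comp (ha.mul h2))

theorem continuous_hPair_sq {X : Type*} [TopologicalSpace X] (hq : ‖q‖ < 1) {t : X → ℝ}
    (ht : Continuous t) :
    Continuous fun x => hPair q (circleMap 0 1 (t x) ^ 2) 1 := by
  have h1 := (continuous_circleMap 0 1).comp ht
  have h2 := continuous_inv_circleMap_one.comp ht
  simp only [hPair, one_mul, ← inv_pow]
  exact ((continuous_qShiftInf hq).comp (h1.pow 2)).mul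
    ((continuous_qShiftInf hq).comp (h2.pow 2))

theorem continuous_rahmanKernel {X : Type*} [TopologicalSpace X] (hq : ‖q‖ < 1)
    {f a b c d r : X → ℂ} {t : X → ℝ} (hf : Continuous f) (ha : Continuous a)
    (hb : Continuous b) (hc : Continuous c) (hd : Continuous d) (hr : Continuous r)
    (ht : Continuous t) (na : ∀ x, ‖a x‖ < 1) (nb : ∀ x, ‖b x‖ < 1) (nc : ∀ x, ‖c x‖ < 1)
    (nd : ∀ x, ‖d x‖ < 1) (nr : ∀ x, ‖r x‖ < 1) :
    Continuous fun x =>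
      rahmanKernel q (f x) (a x) (b x) (c x) (d x) (r x) (circleMap 0 1 (t x)) := by
  refine Continuous.div ((continuous_hPair_sq hq ht).mul (continuous_hPair hq hf ht))
    (((((continuous_hPair hq ha ht).mul (continuous_hPair hq hb ht)).mul
      (continuous_hPair hq hc ht)).mul (continuous_hPair hq hd ht)).mul
        (continuous_hPair hq hr ht)) fun x => ?_
  have hw := norm_circleMap_one (t x)
  exact mul_ne_zero (mul_ne_zero (mul_ne_zero (mul_ne_zero (hPair_ne_zero hq hw (na x))
    (hPair_ne_zero hq hw (nb x))) (hPair_ne_zero hq hw (nc x))) (hPair_ne_zero hq hw (nd x)))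
    (hPair_ne_zero hq hw (nr x))

theorem intervalIntegral_circleMap_inv (F : ℂ → ℂ) :
    ∫ θ in (0 : ℝ)..2 * Real.pi, F (circleMap 0 1 θ)⁻¹ =
      ∫ θ in (0 : ℝ)..2 * Real.pi, F (circleMap 0 1 θ) := by
  have h := intervalIntegral.integral_comp_sub_left (a := 0) (b := 2 * Real.pi)
    (fun θ => F (circleMap 0 1 θ)) (2 * Real.pi)
  rw [sub_self, sub_zero] at h
  rw [← h]
  refine intervalIntegral.integral_congr fun θ _ => ?_
  congr 1
  simp [circleMap, sub_mul, Complex.exp_sub, Complex.exp_two_pi_mul_I]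

/-- Cauchy's theorem for `g(w) dw/w` on the annulus, since `dw/w = i dθ` on each circle. -/
theorem intervalIntegral_circleMap_eq_of_annulus {g : ℂ → ℂ} {R : ℝ} (hR : 1 ≤ R)
    (hg : ∀ z, 1 ≤ ‖z‖ → ‖z‖ ≤ R → DifferentiableAt ℂ g z) :
    ∫ θ in (0 : ℝ)..2 * Real.pi, g (circleMap 0 R θ) =
      ∫ θ in (0 : ℝ)..2 * Real.pi, g (circleMap 0 1 θ) := by
  have h := Complex.circleIntegral_sub_center_inv_smul_eq_of_differentiable_on_annulus_off_countable
    (c := 0) (f := g) one_pos hR Set.countable_empty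
    (fun z hz => (hg z (by simpa using hz.2) (by simpa using hz.1)).continuousAt.continuousWithinAt)
    (fun z hz => hg z (by simpa using (not_le.1 (fun h => hz.1.2 (by simpa using h))).le)
      (by simpa using (Metric.mem_ball.1 hz.1.1).le))
  simp only [circleIntegral, sub_zero, deriv_circleMap, smul_eq_mul] at h
  have key : ∀ S : ℝ, 0 < S → (∫ θ in (0 : ℝ)..2 * Real.pi,
      circleMap 0 S θ * Complex.I * ((circleMap 0 S θ)⁻¹ * g (circleMap 0 S θ))) =
      Complex.I * ∫ θ in (0 : ℝ)..2 * Real.pi, g (circleMap 0 S θ) := by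
    intro S hS
    rw [← intervalIntegral.integral_const_mul]
    refine intervalIntegral.integral_congr fun θ _ => ?_
    have : circleMap 0 S θ ≠ 0 := by simp [hS.ne']
    field_simp
  rw [key R (one_pos.trans_le hR), key 1 one_pos] at h
  exact mul_left_cancel₀ Complex.I_ne_zero h

/-- The function whose `q`-shift produces the contiguous relation for `rahmanIntegral`. -/
noncomputable def shiftKernel (q f a b c d r w : ℂ) : ℂ :=
  w⁻¹ * (qShiftInf q (q * w ^ 2) * qShiftInf q (w⁻¹ ^ 2) * (qShiftInf q (f * q * w) *
    qShiftInf q (f * w⁻¹))) /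
      ((qShiftInf q (a * q * w) * qShiftInf q (a * w⁻¹)) *
       (qShiftInf q (b * q * w) * qShiftInf q (b * w⁻¹)) *
       (qShiftInf q (c * q * w) * qShiftInf q (c * w⁻¹)) *
       (qShiftInf q (d * q * w) * qShiftInf q (d * w⁻¹)) *
       (qShiftInf q (r * q * w) * qShiftInf q (r * w⁻¹)))

theorem shiftKernel_div (hq : ‖q‖ < 1) (hq0 : q ≠ 0) (f a b c d r : ℂ) {w : ℂ} (hw : w ≠ 0) :
    shiftKernel q f a b c d r (w / q) = -shiftKernel q f a b c d r w⁻¹ := by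
  have e1 : ∀ x : ℂ, x * q * (w / q) = x * w := fun x => by field_simp
  have e2 : ∀ x : ℂ, x * (w / q)⁻¹ = x * q * w⁻¹ := fun x => by field_simp
  have e3 : q * (w / q) ^ 2 = w ^ 2 / q := by field_simp
  have e4 : (w / q)⁻¹ ^ 2 = q * w⁻¹ ^ 2 * q := by field_simp
  have e5 : w ^ 2 / q * q = w ^ 2 := by field_simp
  have h1 := qShiftInf_eq_one_sub_mul hq (w ^ 2 / q)
  have h2 := qShiftInf_eq_one_sub_mul hq (q * w⁻¹ ^ 2)
  rw [e5] at h1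
  simp only [shiftKernel, e1, e2, e3, e4, inv_inv, h1, h2]
  have h3 : (w / q)⁻¹ * (1 - w ^ 2 / q) = -(w * (1 - q * w⁻¹ ^ 2)) := by
    field_simp
    ring
  linear_combination (qShiftInf q (w ^ 2) * qShiftInf q (q * w⁻¹ ^ 2 * q) *
    (qShiftInf q (f * w) * qShiftInf q (f * q * w⁻¹)) /
      ((qShiftInf q (a * w) * qShiftInf q (a * q * w⁻¹)) *
       (qShiftInf q (b * w) * qShiftInf q (b * q * w⁻¹)) *
       (qShiftInf q (c * w) * qShiftInf q (c * q * w⁻¹)) *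
       (qShiftInf q (d * w) * qShiftInf q (d * q * w⁻¹)) *
       (qShiftInf q (r * w) * qShiftInf q (r * q * w⁻¹)))) * h3

/-- For each parameter `x`, both `xqw` and `x/w` lie in the open unit disc when `1 ≤ |w| ≤ 1/|q|`,
so no pole meets the closed annulus. -/
theorem differentiableAt_shiftKernel (hq : ‖q‖ < 1) (f : ℂ) {a b c d r w : ℂ} (ha : ‖a‖ < 1)
    (hb : ‖b‖ < 1) (hc : ‖c‖ < 1) (hd : ‖d‖ < 1) (hr : ‖r‖ < 1) (hw1 : 1 ≤ ‖w‖)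
    (hwq : ‖q * w‖ ≤ 1) : DifferentiableAt ℂ (shiftKernel q f a b c d r) w := by
  have hw0 : w ≠ 0 := norm_pos_iff.1 (one_pos.trans_le hw1)
  have hE := differentiable_qShiftInf hq
  have hinv : ‖w⁻¹‖ ≤ 1 := by rw [norm_inv]; exact inv_le_one_of_one_le₀ hw1
  have n1 : ∀ x : ℂ, ‖x‖ < 1 → qShiftInf q (x * q * w) ≠ 0 := fun x hx =>
    qShiftInf_ne_zero hq (by
      rw [mul_assoc, norm_mul]
      exact (mul_le_of_le_one_right (norm_nonneg _) hwq).trans_lt hx)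
  have n2 : ∀ x : ℂ, ‖x‖ < 1 → qShiftInf q (x * w⁻¹) ≠ 0 := fun x hx =>
    qShiftInf_ne_zero hq (by
      rw [norm_mul]
      exact (mul_le_of_le_one_right (norm_nonneg _) hinv).trans_lt hx)
  have d0 : DifferentiableAt ℂ (fun w : ℂ => w⁻¹) w := differentiableAt_inv hw0
  have d1 : ∀ x : ℂ, DifferentiableAt ℂ (fun w => qShiftInf q (x * w)) w := fun x =>
    (hE _).fun_comp' w (differentiableAt_id.const_mul x)
  have d2 : ∀ x : ℂ, DifferentiableAt ℂ (fun w => qShiftInf q (x * w⁻¹)) w := fun x =>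
    (hE _).fun_comp' w (d0.const_mul x)
  have d3 : DifferentiableAt ℂ (fun w => qShiftInf q (q * w ^ 2)) w :=
    (hE _).fun_comp' w ((differentiableAt_id.pow 2).const_mul q)
  have d4 : DifferentiableAt ℂ (fun w => qShiftInf q (w⁻¹ ^ 2)) w :=
    (hE _).fun_comp' w (d0.pow 2)
  refine DifferentiableAt.div (d0.mul ((d3.mul d4).mul ((d1 _).mul (d2 _))))
    ((((((d1 _).mul (d2 _)).mul ((d1 _).mul (d2 _))).mul ((d1 _).mul (d2 _))).mul
      ((d1 _).mul (d2 _))).mul ((d1 _).mul (d2 _))) ?_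
  simp only [ne_eq, mul_eq_zero, not_or]
  exact ⟨⟨⟨⟨⟨n1 a ha, n2 a ha⟩, n1 b hb, n2 b hb⟩, n1 c hc, n2 c hc⟩, n1 d hd, n2 d hd⟩,
    n1 r hr, n2 r hr⟩

/-- What remains of the contiguous relation after the common infinite products are removed. The
balancing `f = abcdr` is essential here. -/
theorem rahman_contiguous_identity (a b c d r : ℂ) {w v : ℂ} (h : w * v = 1) :
    a * (1 - a * b * c * d * r * a) *
      ((1 - v ^ 2) * (1 - a * b * c * d * r * v) * v *
        ((1 - a * w) * (1 - b * w) * (1 - c * w) * (1 - d * w) * (1 - r * w)) +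
       (1 - w ^ 2) * (1 - a * b * c * d * r * w) * w *
        ((1 - a * v) * (1 - b * v) * (1 - c * v) * (1 - d * v) * (1 - r * v))) =
    (1 - w ^ 2) * (1 - v ^ 2) *
      ((1 - a * b) * (1 - a * c) * (1 - a * d) * (1 - a * r) *
        ((1 - a * b * c * d * r * w) * (1 - a * b * c * d * r * v)) -
       (1 - a * b * c * d) * (1 - a * b * c * r) * (1 - a * b * d * r) * (1 - a * c * d * r) *
        ((1 - a * w) * (1 - a * v))) := by
  have hw : w ≠ 0 := left_ne_zero_of_mul_eq_one h
  obtain rfl : v = w⁻¹ := eq_inv_of_mul_eq_one_right h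
  field_simp
  ring

theorem shiftKernel_add_inv (hq : ‖q‖ < 1) {a b c d r w : ℂ} (ha : ‖a‖ < 1)
    (hb : ‖b‖ < 1) (hc : ‖c‖ < 1) (hd : ‖d‖ < 1) (hr : ‖r‖ < 1) (hw : ‖w‖ = 1) :
    a * (1 - a * b * c * d * r * a) * (shiftKernel q (a * b * c * d * r) a b c d r w +
        shiftKernel q (a * b * c * d * r) a b c d r w⁻¹) =
      (1 - a * b) * (1 - a * c) * (1 - a * d) * (1 - a * r) *
        rahmanKernel q (a * b * c * d * r) a b c d r w -
      (1 - a * b * c * d) * (1 - a * b * c * r) * (1 - a * b * d * r) * (1 - a * c * d * r) *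
        rahmanKernel q (a * q * b * c * d * r) (a * q) b c d r w := by
  have hw0 : w ≠ 0 := norm_pos_iff.1 (hw ▸ one_pos)
  have key : ∀ x : ℂ, qShiftInf q (x * w) = (1 - x * w) * qShiftInf q (x * q * w) := fun x => by
    rw [qShiftInf_eq_one_sub_mul hq, mul_right_comm]
  have key' : ∀ x : ℂ, qShiftInf q (x * w⁻¹) = (1 - x * w⁻¹) * qShiftInf q (x * q * w⁻¹) :=
    fun x => by rw [qShiftInf_eq_one_sub_mul hq, mul_right_comm]
  have n1 : ∀ x : ℂ, ‖x‖ < 1 → 1 - x * w ≠ 0 := fun x hx =>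
    one_sub_ne_zero_of_norm_lt (by simpa [hw])
  have n2 : ∀ x : ℂ, ‖x‖ < 1 → 1 - x * w⁻¹ ≠ 0 := fun x hx =>
    one_sub_ne_zero_of_norm_lt (by simpa [hw])
  have n3 : ∀ x : ℂ, ‖x‖ < 1 → qShiftInf q (x * q * w) ≠ 0 := fun x hx =>
    qShiftInf_ne_zero hq (by simpa [hw] using norm_mul_lt_one hx hq)
  have n4 : ∀ x : ℂ, ‖x‖ < 1 → qShiftInf q (x * q * w⁻¹) ≠ 0 := fun x hx =>
    qShiftInf_ne_zero hq (by simpa [hw] using norm_mul_lt_one hx hq)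
  have k1 : qShiftInf q (w ^ 2) = (1 - w ^ 2) * qShiftInf q (q * w ^ 2) := by
    rw [qShiftInf_eq_one_sub_mul hq, mul_comm q]
  have k2 : qShiftInf q (w⁻¹ ^ 2) = (1 - w⁻¹ ^ 2) * qShiftInf q (q * w⁻¹ ^ 2) := by
    rw [qShiftInf_eq_one_sub_mul hq, mul_comm q]
  have hf : a * q * b * c * d * r = a * b * c * d * r * q := by ring
  simp only [shiftKernel, rahmanKernel, hPair, one_mul, inv_inv, ← inv_pow, hf, k1, k2]
  rw [key a, key b, key c, key d, key r, key' a, key' b, key' c, key' d, key' r,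
    key (a * b * c * d * r), key' (a * b * c * d * r)]
  have a1 := n1 a ha
  have b1 := n1 b hb
  have c1 := n1 c hc
  have d1 := n1 d hd
  have r1 := n1 r hr
  have a2 := n2 a ha
  have b2 := n2 b hb
  have c2 := n2 c hc
  have d2 := n2 d hd
  have r2 := n2 r hr
  have a3 := n3 a ha
  have b3 := n3 b hb
  have c3 := n3 c hc
  have d3 := n3 d hd
  have r3 := n3 r hr
  have a4 := n4 a ha
  have b4 := n4 b hb
  have c4 := n4 c hc
  have d4 := n4 d hd
  have r4 := n4 r hr
  have hwv : w * w⁻¹ = 1 := mul_inv_cancel₀ hw0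
  have hid := rahman_contiguous_identity a b c d r hwv
  clear key key' n1 n2 n3 n4 k1 k2 hf
  generalize w⁻¹ = v at *
  generalize qShiftInf q (a * q * w) = A1 at *
  generalize qShiftInf q (b * q * w) = B1 at *
  generalize qShiftInf q (c * q * w) = C1 at *
  generalize qShiftInf q (d * q * w) = D1 at *
  generalize qShiftInf q (r * q * w) = R1 at *
  generalize qShiftInf q (a * q * v) = A2 at *
  generalize qShiftInf q (b * q * v) = B2 at *
  generalize qShiftInf q (c * q * v) = C2 at *
  generalize qShiftInf q (d * q * v) = D2 at *
  generalize qShiftInf q (r * q * v) = R2 at *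
  generalize qShiftInf q (a * b * c * d * r * q * w) = F1 at *
  generalize qShiftInf q (a * b * c * d * r * q * v) = F2 at *
  generalize qShiftInf q (q * w ^ 2) = S1 at *
  generalize qShiftInf q (q * v ^ 2) = S2 at *
  generalize 1 - a * b * c * d * r * w = f1 at *
  generalize 1 - a * b * c * d * r * v = f2 at *
  generalize 1 - w ^ 2 = s1 at *
  generalize 1 - v ^ 2 = s2 at *
  generalize (1 - a * b) * (1 - a * c) * (1 - a * d) * (1 - a * r) = β at *
  generalize (1 - a * b * c * d) * (1 - a * b * c * r) * (1 - a * b * d * r) *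
    (1 - a * c * d * r) = α at *
  generalize a * (1 - a * b * c * d * r * a) = κ at *
  generalize 1 - a * w = a1 at *
  generalize 1 - b * w = b1 at *
  generalize 1 - c * w = c1 at *
  generalize 1 - d * w = d1 at *
  generalize 1 - r * w = r1 at *
  generalize 1 - a * v = a2 at *
  generalize 1 - b * v = b2 at *
  generalize 1 - c * v = c2 at *
  generalize 1 - d * v = d2 at *
  generalize 1 - r * v = r2 at *
  field_simp
  linear_combination (S1 * S2 * F1 * F2) * hid

end AskeyKernel

/-! ### The balanced integral of Nassrallah and Rahman -/

section NassrallahRahman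

variable {q : ℝ}

theorem norm_ofReal_lt_one (hq0 : 0 < q) (hq1 : q < 1) : ‖(q : ℂ)‖ < 1 := by
  rwa [Complex.norm_of_nonneg hq0.le]

theorem continuous_shiftKernel_circleMap {q : ℂ} (hq : ‖q‖ < 1) (f : ℂ) {a b c d r : ℂ}
    (ha : ‖a‖ < 1) (hb : ‖b‖ < 1) (hc : ‖c‖ < 1) (hd : ‖d‖ < 1) (hr : ‖r‖ < 1) :
    Continuous fun θ => shiftKernel q f a b c d r (circleMap 0 1 θ) :=
  continuous_iff_continuousAt.2 fun θ =>
    ContinuousAt.comp (f := circleMap 0 1) (differentiableAt_shiftKernel hq f ha hb hc hd hr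
      (norm_circleMap_one θ).ge (by simpa using hq.le)).continuousAt
      (continuous_circleMap 0 1).continuousAt

/-- Moving the contour from `|w| = 1` to `|w| = 1/q` and using `G(w/q) = -G(1/w)` shows that the
integral equals its own negative. -/
theorem integral_shiftKernel (hq0 : 0 < q) (hq1 : q < 1) (f : ℂ) {a b c d r : ℂ}
    (ha : ‖a‖ < 1) (hb : ‖b‖ < 1) (hc : ‖c‖ < 1) (hd : ‖d‖ < 1) (hr : ‖r‖ < 1) :
    ∫ θ in (0 : ℝ)..2 * Real.pi, shiftKernel q f a b c d r (circleMap 0 1 θ) = 0 := by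
  have hq := norm_ofReal_lt_one hq0 hq1
  have hqc : (q : ℂ) ≠ 0 := by exact_mod_cast hq0.ne'
  have h1 := intervalIntegral_circleMap_eq_of_annulus (g := shiftKernel q f a b c d r)
    (R := 1 / q) (by rw [le_div_iff₀ hq0]; linarith) (fun z hz1 hz2 =>
      differentiableAt_shiftKernel hq f ha hb hc hd hr hz1 (by
        rw [norm_mul, Complex.norm_of_nonneg hq0.le]
        rwa [le_div_iff₀ hq0, mul_comm] at hz2))
  have h2 : ∀ θ, circleMap 0 (1 / q) θ = circleMap 0 1 θ / q := fun θ => by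
    simp [circleMap]; ring
  simp only [h2, shiftKernel_div hq hqc _ _ _ _ _ _ (circleMap_one_ne_zero _),
    intervalIntegral.integral_neg] at h1
  rw [intervalIntegral_circleMap_inv (fun w => shiftKernel q f a b c d r w)] at h1
  linear_combination (-1 / 2 : ℂ) * h1

theorem intervalIntegrable_rahmanKernel {q : ℂ} (hq : ‖q‖ < 1) (f : ℂ) {a b c d r : ℂ}
    (ha : ‖a‖ < 1) (hb : ‖b‖ < 1) (hc : ‖c‖ < 1) (hd : ‖d‖ < 1) (hr : ‖r‖ < 1) (x y : ℝ) :
    IntervalIntegrable (fun θ => rahmanKernel q f a b c d r (circleMap 0 1 θ))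
      MeasureTheory.volume x y :=
  (continuous_rahmanKernel hq continuous_const continuous_const continuous_const continuous_const
    continuous_const continuous_const continuous_id (fun _ => ha) (fun _ => hb) (fun _ => hc)
    (fun _ => hd) (fun _ => hr)).intervalIntegrable x y

/-- Contiguous relation in the parameter `a`. -/
theorem rahmanIntegral_contiguous (hq0 : 0 < q) (hq1 : q < 1) {a b c d r : ℂ}
    (ha : ‖a‖ < 1) (hb : ‖b‖ < 1) (hc : ‖c‖ < 1) (hd : ‖d‖ < 1) (hr : ‖r‖ < 1) :
    (1 - a * b) * (1 - a * c) * (1 - a * d) * (1 - a * r) * rahmanIntegral q a b c d r =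
      (1 - a * b * c * d) * (1 - a * b * c * r) * (1 - a * b * d * r) * (1 - a * c * d * r) *
        rahmanIntegral q (a * q) b c d r := by
  by_cases h0 : a = 0
  · simp [h0]
  have hq := norm_ofReal_lt_one hq0 hq1
  have haq := norm_mul_lt_one ha hq
  rw [← sub_eq_zero, rahmanIntegral, rahmanIntegral, ← intervalIntegral.integral_const_mul,
    ← intervalIntegral.integral_const_mul, ← intervalIntegral.integral_sub
      ((intervalIntegrable_rahmanKernel hq _ ha hb hc hd hr _ _).const_mul _)
      ((intervalIntegrable_rahmanKernel hq _ haq hb hc hd hr _ _).const_mul _)]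
  simp only [← shiftKernel_add_inv hq ha hb hc hd hr (norm_circleMap_one _)]
  have hcont := continuous_shiftKernel_circleMap hq (a * b * c * d * r) ha hb hc hd hr
  have hcont' : Continuous fun θ =>
      shiftKernel q (a * b * c * d * r) a b c d r (circleMap 0 1 θ)⁻¹ := by
    have := hcont.comp continuous_neg
    refine this.congr fun θ => ?_
    simp [circleMap, Complex.exp_neg]
  rw [intervalIntegral.integral_const_mul, intervalIntegral.integral_add
    (hcont.intervalIntegrable _ _) (hcont'.intervalIntegrable _ _),
    intervalIntegral_circleMap_inv (fun w => shiftKernel q (a * b * c * d * r) a b c d r w),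
    integral_shiftKernel hq0 hq1 _ ha hb hc hd hr]
  simp

theorem tendsto_rahmanIntegral_mul_pow {q : ℂ} (hq : ‖q‖ < 1) {a b c d r : ℂ}
    (ha : ‖a‖ < 1) (hb : ‖b‖ < 1) (hc : ‖c‖ < 1) (hd : ‖d‖ < 1) (hr : ‖r‖ < 1) :
    Tendsto (fun n : ℕ => rahmanIntegral q (a * q ^ n) b c d r) atTop
      (𝓝 (rahmanIntegral q 0 b c d r)) := by
  -- The parameter `a` ranges over the open unit disc as a subtype, where the denominator of the
  -- kernel never vanishes.
  have : LocallyCompactSpace (Metric.ball (0 : ℂ) 1) := Metric.isOpen_ball.locallyCompactSpace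
  have hker : Continuous (Function.uncurry fun (x : Metric.ball (0 : ℂ) 1) (θ : ℝ) =>
      rahmanKernel q ((x : ℂ) * b * c * d * r) x b c d r (circleMap 0 1 θ)) :=
    continuous_rahmanKernel (X := Metric.ball (0 : ℂ) 1 × ℝ) (a := fun x => (x.1 : ℂ))
      (b := fun _ => b) (c := fun _ => c) (d := fun _ => d) (r := fun _ => r)
      (f := fun x => (x.1 : ℂ) * b * c * d * r) (t := fun x => x.2) hq
      (by fun_prop) (by fun_prop) (by fun_prop) (by fun_prop) (by fun_prop) (by fun_prop)
      (by fun_prop) (fun x => mem_ball_zero_iff.1 x.1.2) (fun _ => hb) (fun _ => hc)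
      (fun _ => hd) (fun _ => hr)
  have hcont : Continuous fun x : Metric.ball (0 : ℂ) 1 => rahmanIntegral q x b c d r :=
    intervalIntegral.continuous_parametric_intervalIntegral_of_continuous' hker 0 (2 * Real.pi)
  have hs : Tendsto (fun n : ℕ => (⟨a * q ^ n, mem_ball_zero_iff.2 (norm_mul_pow_lt hq ha n)⟩ :
      Metric.ball (0 : ℂ) 1)) atTop (𝓝 ⟨0, by simp⟩) := by
    rw [tendsto_subtype_rng]
    simpa using (tendsto_pow_atTop_nhds_zero_of_norm_lt_one hq).const_mul a
  have h := (hcont.tendsto ⟨0, by simp⟩).comp hs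
  simpa only [Function.comp_def] using h

theorem qShift_mul_rahmanIntegral (hq0 : 0 < q) (hq1 : q < 1) {a b c d r : ℂ}
    (ha : ‖a‖ < 1) (hb : ‖b‖ < 1) (hc : ‖c‖ < 1) (hd : ‖d‖ < 1) (hr : ‖r‖ < 1) (n : ℕ) :
    qShift q (a * b) n * qShift q (a * c) n * qShift q (a * d) n *
      qShift q (a * r) n * rahmanIntegral q a b c d r =
      qShift q (a * b * c * d) n * qShift q (a * b * c * r) n * qShift q (a * b * d * r) n *
        qShift q (a * c * d * r) n * rahmanIntegral q (a * q ^ n) b c d r := by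
  have hq := norm_ofReal_lt_one hq0 hq1
  induction n with
  | zero => simp [qShift]
  | succ n ih =>
    have h := rahmanIntegral_contiguous hq0 hq1 (norm_mul_pow_lt hq ha n) hb hc hd hr
    simp only [qShift_succ, pow_succ, ← mul_assoc]
    linear_combination ((1 - a * b * (q : ℂ) ^ n) * (1 - a * c * (q : ℂ) ^ n) *
      (1 - a * d * (q : ℂ) ^ n) * (1 - a * r * (q : ℂ) ^ n)) * ih +
      (qShift q (a * b * c * d) n * qShift q (a * b * c * r) n * qShift q (a * b * d * r) n *
      qShift q (a * c * d * r) n) * h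

theorem qShiftInf_mul_rahmanIntegral (hq0 : 0 < q) (hq1 : q < 1) {a b c d r : ℂ}
    (ha : ‖a‖ < 1) (hb : ‖b‖ < 1) (hc : ‖c‖ < 1) (hd : ‖d‖ < 1) (hr : ‖r‖ < 1) :
    qShiftInf q (a * b) * qShiftInf q (a * c) * qShiftInf q (a * d) * qShiftInf q (a * r) *
        rahmanIntegral q a b c d r =
      qShiftInf q (a * b * c * d) * qShiftInf q (a * b * c * r) * qShiftInf q (a * b * d * r) *
        qShiftInf q (a * c * d * r) * rahmanIntegral q 0 b c d r := by
  have hq := norm_ofReal_lt_one hq0 hq1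
  have hstep := qShift_mul_rahmanIntegral hq0 hq1 ha hb hc hd hr
  have h1 := ((((tendsto_qShift hq (a * b)).mul (tendsto_qShift hq (a * c))).mul
    (tendsto_qShift hq (a * d))).mul (tendsto_qShift hq (a * r))).mul
      (tendsto_const_nhds (x := rahmanIntegral q a b c d r))
  have h2 := ((((tendsto_qShift hq (a * b * c * d)).mul (tendsto_qShift hq (a * b * c * r))).mul
    (tendsto_qShift hq (a * b * d * r))).mul (tendsto_qShift hq (a * c * d * r))).mul
      (tendsto_rahmanIntegral_mul_pow hq ha hb hc hd hr)
  exact tendsto_nhds_unique (h1.congr hstep) h2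

theorem rahmanIntegral_swap₁₂ (q a b c d r : ℂ) :
    rahmanIntegral q a b c d r = rahmanIntegral q b a c d r := by
  simp only [rahmanIntegral, rahmanKernel, mul_comm b a, mul_comm (hPair q _ b)]

theorem rahmanIntegral_swap₁₃ (q a b c d r : ℂ) :
    rahmanIntegral q a b c d r = rahmanIntegral q c b a d r := by
  simp only [rahmanIntegral, rahmanKernel]
  congr 1; funext θ; rw [show c * b * a = a * b * c by ring]; congr 1; ring

theorem rahmanIntegral_swap₁₄ (q a b c d r : ℂ) :
    rahmanIntegral q a b c d r = rahmanIntegral q d b c a r := by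
  simp only [rahmanIntegral, rahmanKernel]
  congr 1; funext θ; rw [show d * b * c * a = a * b * c * d by ring]; congr 1; ring

theorem rahmanIntegral_swap₁₅ (q a b c d r : ℂ) :
    rahmanIntegral q a b c d r = rahmanIntegral q r b c d a := by
  simp only [rahmanIntegral, rahmanKernel]
  congr 1; funext θ; rw [show r * b * c * d * a = a * b * c * d * r by ring]; congr 1; ring

/-- The parameters are sent to `0` one at a time, each being moved to the first slot by symmetry;
with zeros already present most factors become `(0; q)_∞ = 1`. -/
theorem qShiftInf_mul_rahmanIntegral_eq_zero_params (hq0 : 0 < q) (hq1 : q < 1) {a b c d r : ℂ}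
    (ha : ‖a‖ < 1) (hb : ‖b‖ < 1) (hc : ‖c‖ < 1) (hd : ‖d‖ < 1) (hr : ‖r‖ < 1) :
    qShiftInf q (a * b) * qShiftInf q (a * c) * qShiftInf q (a * d) * qShiftInf q (a * r) *
      (qShiftInf q (b * c) * qShiftInf q (b * d) * qShiftInf q (b * r)) *
      (qShiftInf q (c * d) * qShiftInf q (c * r)) * qShiftInf q (d * r) *
        rahmanIntegral q a b c d r =
      qShiftInf q (a * b * c * d) * qShiftInf q (a * b * c * r) * qShiftInf q (a * b * d * r) *
        qShiftInf q (a * c * d * r) * qShiftInf q (b * c * d * r) *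
        rahmanIntegral q 0 0 0 0 0 := by
  have n0 : ‖(0 : ℂ)‖ < 1 := by simp
  have h1 := qShiftInf_mul_rahmanIntegral hq0 hq1 ha hb hc hd hr
  have h2 := qShiftInf_mul_rahmanIntegral hq0 hq1 hb n0 hc hd hr
  have h3 := qShiftInf_mul_rahmanIntegral hq0 hq1 hc n0 n0 hd hr
  have h4 := qShiftInf_mul_rahmanIntegral hq0 hq1 hd n0 n0 n0 hr
  have h5 := qShiftInf_mul_rahmanIntegral hq0 hq1 hr n0 n0 n0 n0
  rw [rahmanIntegral_swap₁₂ q b 0] at h2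
  rw [rahmanIntegral_swap₁₃ q c 0] at h3
  rw [rahmanIntegral_swap₁₄ q d 0] at h4
  rw [rahmanIntegral_swap₁₅ q r 0] at h5
  simp only [mul_zero, zero_mul, qShiftInf_zero, one_mul, mul_one] at h2 h3 h4 h5
  rw [h5] at h4
  rw [← h4]
  linear_combination (qShiftInf q (b * c) * qShiftInf q (b * d) * qShiftInf q (b * r) *
      (qShiftInf q (c * d) * qShiftInf q (c * r)) * qShiftInf q (d * r)) * h1 +
    (qShiftInf q (a * b * c * d) * qShiftInf q (a * b * c * r) * qShiftInf q (a * b * d * r) *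
        qShiftInf q (a * c * d * r) * (qShiftInf q (c * d) * qShiftInf q (c * r)) *
        qShiftInf q (d * r)) * h2 +
    (qShiftInf q (a * b * c * d) * qShiftInf q (a * b * c * r) * qShiftInf q (a * b * d * r) *
        qShiftInf q (a * c * d * r) * qShiftInf q (b * c * d * r) * qShiftInf q (d * r)) * h3

theorem integral_one_sub_sq_mul :
    ∫ θ in (0 : ℝ)..2 * Real.pi, (1 - circleMap 0 1 θ ^ 2) * (1 - (circleMap 0 1 θ)⁻¹ ^ 2) =
      (4 : ℂ) * (Real.pi : ℂ) := by
  have h : ∀ θ : ℝ, (1 - circleMap 0 1 θ ^ 2) * (1 - (circleMap 0 1 θ)⁻¹ ^ 2) =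
      2 - Complex.exp (2 * Complex.I * θ) - Complex.exp (-2 * Complex.I * θ) := by
    intro θ
    have h1 : circleMap 0 1 θ ^ 2 = Complex.exp (2 * Complex.I * θ) := by
      simp only [circleMap, zero_add, Complex.ofReal_one, one_mul, ← Complex.exp_nat_mul]
      congr 1; push_cast; ring
    have h2 : (circleMap 0 1 θ)⁻¹ ^ 2 = Complex.exp (-2 * Complex.I * θ) := by
      rw [inv_pow, h1, ← Complex.exp_neg]; congr 1; ring
    have h3 : Complex.exp (2 * Complex.I * θ) * Complex.exp (-2 * Complex.I * θ) = 1 := by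
      rw [← Complex.exp_add]; ring_nf; simp
    rw [h1, h2]
    linear_combination h3
  have e1 : Complex.exp (2 * Complex.I * ((2 * Real.pi : ℝ) : ℂ)) = 1 := by
    rw [Complex.exp_eq_one_iff]; exact ⟨2, by push_cast; ring⟩
  have e2 : Complex.exp (-2 * Complex.I * ((2 * Real.pi : ℝ) : ℂ)) = 1 := by
    rw [Complex.exp_eq_one_iff]; exact ⟨-2, by push_cast; ring⟩
  simp only [h]
  rw [intervalIntegral.integral_sub, intervalIntegral.integral_sub,
    integral_exp_mul_complex (by simp), integral_exp_mul_complex (by simp), e1, e2]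
  · simp; ring
  all_goals exact Continuous.intervalIntegrable (by fun_prop) _ _

theorem qShiftInf_mul_rahmanIntegral_zero (hq0 : 0 < q) (hq1 : q < 1) :
    qShiftInf q q * rahmanIntegral q 0 0 0 0 0 = 4 * Real.pi := by
  set s : ℂ := (Real.sqrt q : ℂ) with hs
  have hsq : s ^ 2 = q := by
    rw [hs, ← Complex.ofReal_pow, Real.sq_sqrt hq0.le]
  have hs1 : ‖s‖ < 1 := by
    rw [hs, Complex.norm_of_nonneg (Real.sqrt_nonneg q), Real.sqrt_lt' one_pos]
    simpa using hq1
  have hq := norm_ofReal_lt_one hq0 hq1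
  have hs2 : ‖s ^ 2‖ < 1 := hsq ▸ hq
  have quad := qShiftInf_quadruple hs1
  -- With `s = √q`, the quadruple product formula makes the denominator equal to `(qw², qw⁻²)_∞`,
  -- which reduces the kernel to `(1 - w²)(1 - w⁻²)`.
  have h := qShiftInf_mul_rahmanIntegral_eq_zero_params hq0 hq1 (a := s ^ 2) (b := -s ^ 2) (c := s)
    (d := -s) (r := 0) hs2 (by simpa using hs2) hs1 (by simpa using hs1) (by simp)
  have hint : rahmanIntegral q (s ^ 2) (-s ^ 2) s (-s) 0 = 4 * Real.pi := by
    rw [← integral_one_sub_sq_mul, rahmanIntegral]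
    refine intervalIntegral.integral_congr fun θ _ => ?_
    have hw := norm_circleMap_one θ
    generalize circleMap 0 1 θ = w at hw
    have q1 := quad (s * w)
    have q2 := quad (s * w⁻¹)
    rw [hsq] at q1 q2
    have k1 : qShiftInf q (w ^ 2) = (1 - w ^ 2) * qShiftInf q ((s * w) ^ 2) := by
      rw [qShiftInf_eq_one_sub_mul hq, mul_pow, hsq, mul_comm (q : ℂ)]
    have k2 : qShiftInf q (w⁻¹ ^ 2) = (1 - w⁻¹ ^ 2) * qShiftInf q ((s * w⁻¹) ^ 2) := by
      rw [qShiftInf_eq_one_sub_mul hq, mul_pow, hsq, mul_comm (q : ℂ)]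
    have n1 : qShiftInf q ((s * w) ^ 2) ≠ 0 := qShiftInf_ne_zero hq (by
      rw [mul_pow, norm_mul, norm_pow w, hw]; simpa using hs2)
    have n2 : qShiftInf q ((s * w⁻¹) ^ 2) ≠ 0 := qShiftInf_ne_zero hq (by
      rw [mul_pow, norm_mul, norm_pow w⁻¹, norm_inv, hw]; simpa using hs2)
    have hden : hPair q w (s ^ 2) * hPair q w (-s ^ 2) * hPair q w s * hPair q w (-s) *
        hPair q w 0 = qShiftInf q ((s * w) ^ 2) * qShiftInf q ((s * w⁻¹) ^ 2) := by
      rw [← q1, ← q2, hPair_zero]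
      simp only [hPair, sq, neg_mul, mul_assoc]
      ring
    simp only [rahmanKernel, hden]
    rw [mul_zero, hPair_zero, hPair, one_mul, one_mul, ← inv_pow, k1, k2]
    generalize qShiftInf q ((s * w) ^ 2) = x1 at *
    generalize qShiftInf q ((s * w⁻¹) ^ 2) = x2 at *
    generalize w⁻¹ ^ 2 = v
    field_simp
  rw [hint] at h
  have q1 := quad s
  have q3 := quad (s ^ 3)
  have p1 := qShiftInf_eq_one_sub_mul hq s
  have p2 := qShiftInf_eq_one_sub_mul hq (-s)
  have p3 := qShiftInf_eq_one_sub_mul hq (q : ℂ)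
  rw [show s * (q : ℂ) = s ^ 3 by rw [← hsq]; ring] at p1
  rw [show -s * (q : ℂ) = -s ^ 3 by rw [← hsq]; ring] at p2
  rw [show (q : ℂ) * (q : ℂ) = s ^ 4 by rw [← hsq]; ring] at p3
  rw [hsq, show s * s = (q : ℂ) by rw [← hsq]; ring] at q1
  rw [hsq, show s * s ^ 3 = s ^ 4 by ring, show (s ^ 3) ^ 2 = s ^ 6 by ring] at q3
  simp only [mul_zero, qShiftInf_zero, mul_one] at h
  rw [show s ^ 2 * -s ^ 2 = -s ^ 4 by ring, show s ^ 2 * s = s ^ 3 by ring,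
    show s ^ 2 * -s = -s ^ 3 by ring, show -s ^ 2 * s = -s ^ 3 by ring,
    show -s ^ 2 * -s = s ^ 3 by ring, show s * -s = -(q : ℂ) by rw [← hsq]; ring,
    show -s ^ 4 * s * -s = s ^ 6 by ring, ← q3] at h
  have n1 : qShiftInf q (s ^ 3) ≠ 0 := by
    refine qShiftInf_ne_zero hq ?_
    rw [norm_pow]; exact pow_lt_one₀ (norm_nonneg _) hs1 (by norm_num)
  have n2 : qShiftInf q (-s ^ 3) ≠ 0 := by
    refine qShiftInf_ne_zero hq ?_
    rw [norm_neg, norm_pow]; exact pow_lt_one₀ (norm_nonneg _) hs1 (by norm_num)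
  have n3 : qShiftInf q (-s ^ 4) ≠ 0 := by
    refine qShiftInf_ne_zero hq ?_
    rw [norm_neg, norm_pow]; exact pow_lt_one₀ (norm_nonneg _) hs1 (by norm_num)
  have n4 : qShiftInf q (q : ℂ) ≠ 0 := qShiftInf_ne_zero hq hq
  have h' : 4 * Real.pi * (qShiftInf q (s ^ 3) * qShiftInf q (-s ^ 3) * qShiftInf q (-(q : ℂ))) =
      qShiftInf q (s ^ 4) * rahmanIntegral q 0 0 0 0 0 := by
    refine mul_left_cancel₀ (mul_ne_zero (mul_ne_zero n1 n2) n3) ?_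
    linear_combination h
  -- Euler's identity `(√q, -√q, -q; q)_∞ = 1`: the quadruple formula at `w = s` with `(q; q)_∞`
  -- cancelled.
  have q1' : qShiftInf q s * qShiftInf q (-s) * qShiftInf q (-(q : ℂ)) = 1 :=
    mul_left_cancel₀ n4 (by linear_combination q1)
  rw [p3]
  rw [p1, p2] at q1'
  rw [← hsq] at *
  linear_combination -(1 - s ^ 2) * h' + 4 * Real.pi * q1'

/-- The Nassrallah–Rahman integral over a full period. -/
theorem rahmanIntegral_eq (hq0 : 0 < q) (hq1 : q < 1) {a b c d r : ℂ}
    (ha : ‖a‖ < 1) (hb : ‖b‖ < 1) (hc : ‖c‖ < 1) (hd : ‖d‖ < 1) (hr : ‖r‖ < 1) :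
    rahmanIntegral q a b c d r = 4 * Real.pi *
      (qShiftInf q (a * b * c * d) * qShiftInf q (a * b * c * r) * qShiftInf q (a * b * d * r) *
        qShiftInf q (a * c * d * r) * qShiftInf q (b * c * d * r)) /
      (qShiftInf q q * (qShiftInf q (a * b) * qShiftInf q (a * c) * qShiftInf q (a * d) *
        qShiftInf q (a * r)) * (qShiftInf q (b * c) * qShiftInf q (b * d) * qShiftInf q (b * r) *
      qShiftInf q (c * d) * qShiftInf q (c * r) * qShiftInf q (d * r))) := by
  have hq := norm_ofReal_lt_one hq0 hq1
  have h := qShiftInf_mul_rahmanIntegral_eq_zero_params hq0 hq1 ha hb hc hd hr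
  have h0 := qShiftInf_mul_rahmanIntegral_zero hq0 hq1
  have n : ∀ x y : ℂ, ‖x‖ < 1 → ‖y‖ < 1 → qShiftInf q (x * y) ≠ 0 := fun x y hx hy =>
    qShiftInf_ne_zero hq (norm_mul_lt_one hx hy)
  rw [eq_div_iff]
  · rw [← h0]
    linear_combination qShiftInf q q * h
  · simp [n _ _ ha hb, n _ _ ha hc, n _ _ ha hd, n _ _ ha hr, n _ _ hb hc, n _ _ hb hd,
      n _ _ hb hr, n _ _ hc hd, n _ _ hc hr, n _ _ hd hr, qShiftInf_ne_zero hq hq]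

end NassrallahRahman

/-! ### Expansion of the general integral in balanced integrals -/

section WellPoisedIntegral

theorem hProd_eq_hPair {q : ℂ} (hq : ‖q‖ < 1) {x : ℝ} {w : ℂ} (hw : w ≠ 0)
    (hx : 2 * (x : ℂ) = w + w⁻¹) (α : ℂ) : hProd q x α = hPair q w α := by
  rw [hPair, qShiftInf, qShiftInf, ← (multipliable_one_sub_mul_pow hq (α * w)).tprod_mul
    (multipliable_one_sub_mul_pow hq (α * w⁻¹)), hProd]
  refine tprod_congr fun k => ?_
  have hwv : w * w⁻¹ = 1 := mul_inv_cancel₀ hw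
  linear_combination (-q ^ k * α) * hx - (α ^ 2 * q ^ (2 * k)) * hwv

theorem two_mul_cos_eq (θ : ℝ) :
    2 * ((Real.cos θ : ℝ) : ℂ) = circleMap 0 1 θ + (circleMap 0 1 θ)⁻¹ := by
  simp [circleMap, Complex.cos, ← Complex.exp_neg, mul_div_cancel₀]

theorem alSalamIsmailIntegrand_eq {q : ℂ} (hq : ‖q‖ < 1) (a b c d r z : ℂ) (θ : ℝ) :
    alSalamIsmailIntegrand q a b c d r z θ =
      rahmanKernel q (a * b * c * d * r * z) a b c d r (circleMap 0 1 θ) := by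
  have hw := circleMap_one_ne_zero θ
  have h1 := fun α => hProd_eq_hPair hq hw (two_mul_cos_eq θ) α
  have h2 : hProd q (Real.cos (2 * θ)) 1 = hPair q (circleMap 0 1 θ ^ 2) 1 := by
    refine hProd_eq_hPair hq (pow_ne_zero 2 hw) ?_ 1
    rw [two_mul_cos_eq]
    have : circleMap 0 1 (2 * θ) = circleMap 0 1 θ ^ 2 := by
      simp only [circleMap, zero_add, Complex.ofReal_one, one_mul, ← Complex.exp_nat_mul]
      congr 1; push_cast; ring
    rw [this]
  simp only [alSalamIsmailIntegrand, rahmanKernel, hMulti, Fin.prod_univ_five, h1, h2]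
  rfl

theorem rahmanKernel_inv (q f a b c d r w : ℂ) :
    rahmanKernel q f a b c d r w⁻¹ = rahmanKernel q f a b c d r w := by
  simp only [rahmanKernel, hPair_inv, inv_pow]

/-- The kernel is invariant under `w ↦ 1/w`, that is under `θ ↦ 2π - θ`. -/
theorem integral_rahmanKernel_half {q : ℂ} (hq : ‖q‖ < 1) (f : ℂ) {a b c d r : ℂ}
    (ha : ‖a‖ < 1) (hb : ‖b‖ < 1) (hc : ‖c‖ < 1) (hd : ‖d‖ < 1) (hr : ‖r‖ < 1) :
    ∫ θ in (0 : ℝ)..2 * Real.pi, rahmanKernel q f a b c d r (circleMap 0 1 θ) =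
      2 * ∫ θ in (0 : ℝ)..Real.pi, rahmanKernel q f a b c d r (circleMap 0 1 θ) := by
  have hint := intervalIntegrable_rahmanKernel hq f ha hb hc hd hr
  rw [← intervalIntegral.integral_add_adjacent_intervals (hint 0 Real.pi)
    (hint Real.pi (2 * Real.pi)), two_mul (∫ θ in _.._, _)]
  congr 1
  have h := intervalIntegral.integral_comp_sub_left (a := 0) (b := Real.pi)
    (fun θ => rahmanKernel q f a b c d r (circleMap 0 1 θ)) (2 * Real.pi)
  rw [sub_zero, show 2 * Real.pi - Real.pi = Real.pi by ring] at h
  rw [← h]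
  refine intervalIntegral.integral_congr fun θ _ => ?_
  rw [← rahmanKernel_inv]
  congr 1
  simp [circleMap, sub_mul, Complex.exp_sub, Complex.exp_two_pi_mul_I]

/-- Expansion of the general kernel in balanced kernels with `a` replaced by `a q^k`. -/
theorem hasSum_wpCoeff_mul_rahmanKernel {q : ℂ} (hq : ‖q‖ < 1) (hq0 : q ≠ 0)
    {a b c d r z w : ℂ} (ha : ‖a‖ < 1) (hb : ‖b‖ < 1) (hc : ‖c‖ < 1) (hd : ‖d‖ < 1)
    (hr : ‖r‖ < 1) (hz : z ≠ 0) (hconv : ‖b * c * d * r * z‖ < 1) (hw : ‖w‖ = 1) :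
    HasSum (fun k : ℕ => wpCoeff q (a ^ 2 * b * c * d * r) (b * c * d * r) z k *
        rahmanKernel q (a * q ^ k * b * c * d * r) (a * q ^ k) b c d r w)
      (qShiftInf q (a ^ 2 * b * c * d * r) * qShiftInf q (b * c * d * r) /
        (qShiftInf q (a ^ 2 * b * c * d * r * z) * qShiftInf q (b * c * d * r * z)) *
        rahmanKernel q (a * b * c * d * r * z) a b c d r w) := by
  have hw0 : w ≠ 0 := norm_pos_iff.1 (hw ▸ one_pos)
  have hp : ‖b * c * d * r‖ < 1 :=
    norm_mul_lt_one (norm_mul_lt_one (norm_mul_lt_one hb hc) hd) hr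
  -- With `p = bcdr`, the product `uvp = a²bcdr` is free of `w`, while `puz = fw` and `pvz = f/w`
  -- for `f = abcdrz`. The remaining factors of the kernel are common to all terms.
  have h := (hasSum_wpCoeff_mul hq hq0 hp (u := a * w) (v := a * w⁻¹) (by simpa [hw])
    (by simpa [hw]) hconv hz).mul_right
      (hPair q (w ^ 2) 1 / (hPair q w b * hPair q w c * hPair q w d * hPair q w r))
  have hB : a * w * (a * w⁻¹) * (b * c * d * r) = a ^ 2 * b * c * d * r := by
    field_simp
  rw [hB] at h
  have hfun : ∀ k : ℕ, wpCoeff q (a ^ 2 * b * c * d * r) (b * c * d * r) z k *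
        rahmanKernel q (a * q ^ k * b * c * d * r) (a * q ^ k) b c d r w =
      wpCoeff q (a ^ 2 * b * c * d * r) (b * c * d * r) z k *
        (qShiftInf q (b * c * d * r * (a * w) * q ^ k) *
          qShiftInf q (b * c * d * r * (a * w⁻¹) * q ^ k) /
          (qShiftInf q (a * w * q ^ k) * qShiftInf q (a * w⁻¹ * q ^ k))) *
        (hPair q (w ^ 2) 1 / (hPair q w b * hPair q w c * hPair q w d * hPair q w r)) := by
    intro k
    rw [rahmanKernel, hPair.eq_1 q w (a * q ^ k), hPair.eq_1 q w (_ * r),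
      show a * q ^ k * b * c * d * r * w = b * c * d * r * (a * w) * q ^ k by ring,
      show a * q ^ k * b * c * d * r * w⁻¹ = b * c * d * r * (a * w⁻¹) * q ^ k by ring,
      show a * q ^ k * w = a * w * q ^ k by ring,
      show a * q ^ k * w⁻¹ = a * w⁻¹ * q ^ k by ring]
    ring
  simp only [hfun]
  refine h.trans_eq ?_
  rw [rahmanKernel, hPair.eq_1 q w a, hPair.eq_1 q w (_ * z),
    show a * b * c * d * r * z * w = b * c * d * r * (a * w) * z by ring,
    show a * b * c * d * r * z * w⁻¹ = b * c * d * r * (a * w⁻¹) * z by ring]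
  ring

theorem exists_norm_rahmanKernel_le {q : ℂ} (hq : ‖q‖ < 1) {a b c d r : ℂ}
    (ha : ‖a‖ < 1) (hb : ‖b‖ < 1) (hc : ‖c‖ < 1) (hd : ‖d‖ < 1) (hr : ‖r‖ < 1) :
    ∃ C, ∀ α : ℂ, ‖α‖ ≤ ‖a‖ → ∀ θ ∈ Set.Icc 0 (2 * Real.pi),
      ‖rahmanKernel q (α * b * c * d * r) α b c d r (circleMap 0 1 θ)‖ ≤ C := by
  have hcont := continuous_rahmanKernel
    (X := Metric.closedBall (0 : ℂ) ‖a‖ × Set.Icc (0 : ℝ) (2 * Real.pi))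
    (a := fun x => (x.1 : ℂ)) (b := fun _ => b) (c := fun _ => c) (d := fun _ => d)
    (r := fun _ => r) (f := fun x => (x.1 : ℂ) * b * c * d * r) (t := fun x => (x.2 : ℝ)) hq
    (by fun_prop) (by fun_prop) (by fun_prop) (by fun_prop) (by fun_prop) (by fun_prop)
    (by fun_prop) (fun x => (mem_closedBall_zero_iff.1 x.1.2).trans_lt ha) (fun _ => hb)
    (fun _ => hc) (fun _ => hd) (fun _ => hr)
  have : CompactSpace (Metric.closedBall (0 : ℂ) ‖a‖) :=
    isCompact_iff_compactSpace.1 (isCompact_closedBall _ _)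
  obtain ⟨C, hC⟩ := (isCompact_range hcont.norm).bddAbove
  exact ⟨C, fun α hα θ hθ => hC ⟨(⟨α, mem_closedBall_zero_iff.2 hα⟩, ⟨θ, hθ⟩), rfl⟩⟩

theorem hasSum_wpCoeff_mul_rahmanIntegral {q : ℂ} (hq : ‖q‖ < 1) (hq0 : q ≠ 0)
    {a b c d r z : ℂ} (ha : ‖a‖ < 1) (hb : ‖b‖ < 1) (hc : ‖c‖ < 1) (hd : ‖d‖ < 1)
    (hr : ‖r‖ < 1) (hz : z ≠ 0) (hconv : ‖b * c * d * r * z‖ < 1) :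
    HasSum (fun k : ℕ => wpCoeff q (a ^ 2 * b * c * d * r) (b * c * d * r) z k *
        rahmanIntegral q (a * q ^ k) b c d r)
      (qShiftInf q (a ^ 2 * b * c * d * r) * qShiftInf q (b * c * d * r) /
        (qShiftInf q (a ^ 2 * b * c * d * r * z) * qShiftInf q (b * c * d * r * z)) *
        ∫ θ in (0 : ℝ)..2 * Real.pi,
          rahmanKernel q (a * b * c * d * r * z) a b c d r (circleMap 0 1 θ)) := by
  have hB : ‖a ^ 2 * b * c * d * r * z‖ < 1 := by
    rw [show a ^ 2 * b * c * d * r * z = a * a * (b * c * d * r * z) by ring]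
    exact norm_mul_lt_one (norm_mul_lt_one ha ha) hconv
  obtain ⟨C0, h0, H0⟩ := exists_norm_wpCoeff_le hq (b * c * d * r) hB
  obtain ⟨C1, h1, H1⟩ := exists_norm_pow_mul_prod_sub_pow_le hq (b * c * d * r) hz
  obtain ⟨C2, H2⟩ := exists_norm_rahmanKernel_le hq ha hb hc hd hr
  have haq : ∀ k : ℕ, ‖a * q ^ k‖ ≤ ‖a‖ := fun k => by
    rw [norm_mul, norm_pow]
    exact mul_le_of_le_one_right (norm_nonneg _) (pow_le_one₀ (norm_nonneg _) hq.le)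
  have hsum := (summable_geometric_of_lt_one (norm_nonneg _) hconv).mul_left (C0 * C1)
  simp only [rahmanIntegral, ← intervalIntegral.integral_const_mul]
  -- The coefficients are `O(|bcdrz|^k)` and the balanced kernels at `aq^k` are bounded uniformly in
  -- `k` and `θ` by compactness.
  refine intervalIntegral.hasSum_integral_of_dominated_convergence
    (fun k _ => C0 * C1 * ‖b * c * d * r * z‖ ^ k * C2) (fun k => ?_) (fun k => ?_) ?_ ?_ ?_
  · have := (intervalIntegrable_rahmanKernel hq (a * q ^ k * b * c * d * r)
      (norm_mul_pow_lt hq ha k) hb hc hd hr 0 (2 * Real.pi)).const_mul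
        (wpCoeff q (a ^ 2 * b * c * d * r) (b * c * d * r) z k)
    exact (intervalIntegrable_iff.1 this).aestronglyMeasurable
  · refine Eventually.of_forall fun θ hθ => ?_
    rw [Set.uIoc_of_le Real.two_pi_pos.le] at hθ
    rw [norm_mul]
    have hk := H2 _ (haq k) θ (Set.Ioc_subset_Icc_self hθ)
    refine mul_le_mul ?_ hk (norm_nonneg _) (by positivity)
    refine (H0 z le_rfl k).trans ?_
    rw [mul_assoc C0]
    exact mul_le_mul_of_nonneg_left (H1 k) h0.le
  · exact Eventually.of_forall fun θ _ => hsum.mul_right C2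
  · exact intervalIntegrable_const
  · exact Eventually.of_forall fun θ _ =>
      hasSum_wpCoeff_mul_rahmanKernel hq hq0 ha hb hc hd hr hz hconv (norm_circleMap_one θ)

theorem qShift_mul_one_sub (q t : ℂ) (k : ℕ) :
    qShift q (q * t) k * (1 - t) = qShift q t k * (1 - t * q ^ k) := by
  rw [← qShift_succ, add_comm, qShift_add, mul_comm]
  simp [qShift, mul_comm]

theorem rahmanIntegral_mul_pow {q : ℝ} (hq0 : 0 < q) (hq1 : q < 1) {a b c d r : ℂ}
    (ha : ‖a‖ < 1) (hb : ‖b‖ < 1) (hc : ‖c‖ < 1) (hd : ‖d‖ < 1) (hr : ‖r‖ < 1) (k : ℕ) :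
    rahmanIntegral q (a * q ^ k) b c d r =
      qShift q (a * b) k * qShift q (a * c) k * qShift q (a * d) k * qShift q (a * r) k /
      (qShift q (a * b * c * d) k * qShift q (a * b * c * r) k * qShift q (a * b * d * r) k *
        qShift q (a * c * d * r) k) * rahmanIntegral q a b c d r := by
  have hq := norm_ofReal_lt_one hq0 hq1
  have hab := norm_mul_lt_one ha hb
  have hac := norm_mul_lt_one ha hc
  have n1 := qShift_ne_zero hq (norm_mul_lt_one (norm_mul_lt_one hab hc) hd) k
  have n2 := qShift_ne_zero hq (norm_mul_lt_one (norm_mul_lt_one hab hc) hr) k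
  have n3 := qShift_ne_zero hq (norm_mul_lt_one (norm_mul_lt_one hab hd) hr) k
  have n4 := qShift_ne_zero hq (norm_mul_lt_one (norm_mul_lt_one hac hd) hr) k
  rw [div_mul_eq_mul_div, eq_div_iff (by simp [*])]
  linear_combination -qShift_mul_rahmanIntegral hq0 hq1 ha hb hc hd hr k

end WellPoisedIntegral

/-! ### Identification with the `₈W₇` series -/

section WellPoisedSeries

/-- The very-well-poised factor of a series with `a₁ = t²`. -/
theorem very_well_poised_factor {q t B : ℂ} (hq : ‖q‖ < 1) (hq0 : q ≠ 0) (hB : ‖B‖ < 1)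
    (ht : t ^ 2 = B / q) (hne : B ≠ q) (k : ℕ) :
    qShift q (B / q) (k + 1) * qShift q (q * t) (k + 1) * qShift q (-(q * t)) (k + 1) /
        (qShift q t (k + 1) * qShift q (-t) (k + 1)) =
      qShift q B k * (1 - B * q ^ (2 * k + 1)) := by
  -- Telescoping in `±t` gives `(qt, -qt)_n / (t, -t)_n = (1 - t² q^{2n}) / (1 - t²)`, and `1 - t²`
  -- cancels the first factor of `(B/q)_n`. Only `t²` matters, so the branch of the square root is
  -- irrelevant.
  have h1 := qShift_mul_one_sub q t (k + 1)
  have h2 := qShift_mul_one_sub q (-t) (k + 1)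
  rw [mul_neg] at h2
  have hA : 1 - t ^ 2 ≠ 0 := by
    rw [ht, sub_ne_zero, ne_comm, ne_eq, div_eq_one_iff_eq hq0]; exact hne
  have hfac : ∀ j : ℕ, (1 - t * q ^ j) * (1 - -t * q ^ j) ≠ 0 := by
    intro j
    have : (1 - t * q ^ j) * (1 - -t * q ^ j) = 1 - t ^ 2 * q ^ (2 * j) := by ring
    rw [this]
    cases j with
    | zero => simpa using hA
    | succ j =>
      have : t ^ 2 * q ^ (2 * (j + 1)) = B * q ^ (2 * j + 1) := by
        rw [ht]; field_simp; ring
      rw [this]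
      exact one_sub_ne_zero_of_norm_lt (norm_mul_pow_lt hq hB _)
  have n1 : qShift q t (k + 1) ≠ 0 :=
    Finset.prod_ne_zero_iff.2 fun j _ => left_ne_zero_of_mul (hfac j)
  have n2 : qShift q (-t) (k + 1) ≠ 0 :=
    Finset.prod_ne_zero_iff.2 fun j _ => right_ne_zero_of_mul (hfac j)
  have h3 : qShift q (B / q) (k + 1) = (1 - t ^ 2) * qShift q B k := by
    rw [add_comm, qShift_add, pow_one, div_mul_cancel₀ _ hq0, ht]
    simp [qShift]
  have h4 : B * q ^ (2 * k + 1) = t ^ 2 * q ^ (2 * (k + 1)) := by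
    rw [ht]; field_simp; ring
  rw [div_eq_iff (mul_ne_zero n1 n2), h3, h4]
  refine mul_left_cancel₀ hA ?_
  linear_combination ((1 - t ^ 2) * qShift q B k) * (qShift q (-(q * t)) (k + 1) * (1 + t)) * h1 +
    ((1 - t ^ 2) * qShift q B k) * (qShift q t (k + 1) * (1 - t * q ^ (k + 1))) * h2

theorem veryWellPoisedTerm_eq {q a b c d r z : ℂ} (hq : ‖q‖ < 1) (hq0 : q ≠ 0)
    (hB : ‖a ^ 2 * b * c * d * r‖ < 1) (hz : z ≠ 0) (hne : a ^ 2 * b * c * d * r ≠ q) (k : ℕ) :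
    veryWellPoisedTerm (a ^ 2 * b * c * d * r / q) ![a * b, a * c, a * d, a * r, 1 / z] q
        (b * c * d * r * z) k =
      wpCoeff q (a ^ 2 * b * c * d * r) (b * c * d * r) z k *
        (qShift q (a * b) k * qShift q (a * c) k * qShift q (a * d) k * qShift q (a * r) k /
          (qShift q (a * b * c * d) k * qShift q (a * b * c * r) k * qShift q (a * b * d * r) k *
            qShift q (a * c * d * r) k)) := by
  cases k with
  | zero => simp [veryWellPoisedTerm, basicPhiTerm, qShiftMulti, wpCoeff, qShift]
  | succ k =>
    -- If `bcdr = 0`, both sides vanish for positive index through the power of the argument,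
    -- whatever values the quotients `q a₁ / aᵢ` take.
    by_cases hp : b * c * d * r = 0
    · rw [veryWellPoisedTerm, basicPhiTerm, wpCoeff, hp]
      simp
    obtain ⟨⟨⟨hb, hc⟩, hd⟩, hr⟩ : ((b ≠ 0 ∧ c ≠ 0) ∧ d ≠ 0) ∧ r ≠ 0 := by
      simpa only [mul_ne_zero_iff, ne_eq, mul_eq_zero, not_or] using hp
    -- For `a = 0` the convention `0 / 0 = 0` yields the intended value `0`.
    have e1 : q * (a ^ 2 * b * c * d * r / q) / (a * b) = a * c * d * r := by
      by_cases ha : a = 0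
      · simp [ha]
      · field_simp
    have e2 : q * (a ^ 2 * b * c * d * r / q) / (a * c) = a * b * d * r := by
      by_cases ha : a = 0
      · simp [ha]
      · field_simp
    have e3 : q * (a ^ 2 * b * c * d * r / q) / (a * d) = a * b * c * r := by
      by_cases ha : a = 0
      · simp [ha]
      · field_simp
    have e4 : q * (a ^ 2 * b * c * d * r / q) / (a * r) = a * b * c * d := by
      by_cases ha : a = 0
      · simp [ha]
      · field_simp
    have e5 : q * (a ^ 2 * b * c * d * r / q) / (1 / z) = a ^ 2 * b * c * d * r * z := by
      field_simp
    have ht : ((a ^ 2 * b * c * d * r / q) ^ (1 / 2 : ℂ)) ^ 2 = a ^ 2 * b * c * d * r / q := by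
      rw [one_div]; exact Complex.cpow_nat_inv_pow _ two_ne_zero
    have hf := very_well_poised_factor hq hq0 hB ht hne k
    rw [wpCoeff, ← hf, prod_sub_pow_eq_qShift q _ hz]
    simp only [veryWellPoisedTerm, basicPhiTerm, qShiftMulti, vwpNum, vwpDen,
      Fin.prod_univ_succ, Matrix.cons_val_zero, Matrix.cons_val_succ, Fin.prod_univ_zero,
      e1, e2, e3, e4, e5, mul_one]
    ring

end WellPoisedSeries

/-! ### The integral formula -/

theorem theorem6p1 (q : ℝ) (hq0 : 0 < q) (hq1 : q < 1) (a b c d r z : ℂ)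
    (ha : ‖a‖ < 1) (hb : ‖b‖ < 1) (hc : ‖c‖ < 1) (hd : ‖d‖ < 1) (hr : ‖r‖ < 1)
    (hz : z ≠ 0) (hconv : ‖b * c * d * r * z‖ < 1)
    (hne : a ^ 2 * b * c * d * r ≠ (q : ℂ)) :
    IntervalIntegrable (alSalamIsmailIntegrand (q : ℂ) a b c d r z)
        MeasureTheory.volume 0 Real.pi ∧
      Summable (veryWellPoisedTerm (a ^ 2 * b * c * d * r / (q : ℂ))
        ![a * b, a * c, a * d, a * r, 1 / z] (q : ℂ) (b * c * d * r * z)) ∧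
      ∫ θ in (0 : ℝ)..Real.pi, alSalamIsmailIntegrand (q : ℂ) a b c d r z θ =
        2 * (Real.pi : ℂ) *
            qShiftMultiInf (q : ℂ) ![a * b * c * d, a * b * c * r, a * b * d * r, a * c * d * r,
              a ^ 2 * b * c * d * r * z, b * c * d * r * z] /
            qShiftMultiInf (q : ℂ) ![(q : ℂ), a * b, a * c, a * d, a * r, b * c, b * d, b * r,
              c * d, c * r, d * r, a ^ 2 * b * c * d * r] *
          veryWellPoised (a ^ 2 * b * c * d * r / (q : ℂ))
            ![a * b, a * c, a * d, a * r, 1 / z] (q : ℂ) (b * c * d * r * z) := by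
  have hq := norm_ofReal_lt_one hq0 hq1
  have hqc : (q : ℂ) ≠ 0 := by exact_mod_cast hq0.ne'
  have hE : alSalamIsmailIntegrand (q : ℂ) a b c d r z = fun θ =>
      rahmanKernel q (a * b * c * d * r * z) a b c d r (circleMap 0 1 θ) :=
    funext fun θ => alSalamIsmailIntegrand_eq hq a b c d r z θ
  have hp : ‖b * c * d * r‖ < 1 :=
    norm_mul_lt_one (norm_mul_lt_one (norm_mul_lt_one hb hc) hd) hr
  have hB : ‖a ^ 2 * b * c * d * r‖ < 1 := by
    rw [show a ^ 2 * b * c * d * r = a * a * (b * c * d * r) by ring]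
    exact norm_mul_lt_one (norm_mul_lt_one ha ha) hp
  have hBz : ‖a ^ 2 * b * c * d * r * z‖ < 1 := by
    rw [show a ^ 2 * b * c * d * r * z = a * a * (b * c * d * r * z) by ring]
    exact norm_mul_lt_one (norm_mul_lt_one ha ha) hconv
  have hsum := hasSum_wpCoeff_mul_rahmanIntegral hq hqc ha hb hc hd hr hz hconv
  have hterm : ∀ k : ℕ, wpCoeff q (a ^ 2 * b * c * d * r) (b * c * d * r) z k *
      rahmanIntegral q (a * q ^ k) b c d r = rahmanIntegral q a b c d r *
      veryWellPoisedTerm (a ^ 2 * b * c * d * r / (q : ℂ))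
        ![a * b, a * c, a * d, a * r, 1 / z] (q : ℂ) (b * c * d * r * z) k := fun k => by
    rw [veryWellPoisedTerm_eq hq hqc hB hz hne, rahmanIntegral_mul_pow hq0 hq1 ha hb hc hd hr]
    ring
  simp only [hterm] at hsum
  have n2 : ∀ x y : ℂ, ‖x‖ < 1 → ‖y‖ < 1 → qShiftInf q (x * y) ≠ 0 := fun x y hx hy =>
    qShiftInf_ne_zero hq (norm_mul_lt_one hx hy)
  have n4 : ∀ x y u v : ℂ, ‖x‖ < 1 → ‖y‖ < 1 → ‖u‖ < 1 → ‖v‖ < 1 →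
      qShiftInf q (x * y * u * v) ≠ 0 := fun x y u v hx hy hu hv =>
    qShiftInf_ne_zero hq (norm_mul_lt_one (norm_mul_lt_one (norm_mul_lt_one hx hy) hu) hv)
  have hR := rahmanIntegral_eq hq0 hq1 ha hb hc hd hr
  -- The integrated series is this constant times the `₈W₇` series, so nonvanishing transfers
  -- summability to the latter.
  have hR0 : rahmanIntegral q a b c d r ≠ 0 := by
    rw [hR]
    simp [n2 _ _ ha hb, n2 _ _ ha hc, n2 _ _ ha hd, n2 _ _ ha hr, n2 _ _ hb hc, n2 _ _ hb hd,
      n2 _ _ hb hr, n2 _ _ hc hd, n2 _ _ hc hr, n2 _ _ hd hr, qShiftInf_ne_zero hq hq,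
      n4 _ _ _ _ ha hb hc hd, n4 _ _ _ _ ha hb hc hr, n4 _ _ _ _ ha hb hd hr,
      n4 _ _ _ _ ha hc hd hr, n4 _ _ _ _ hb hc hd hr, Real.pi_ne_zero]
  have hsummable := (summable_mul_left_iff hR0).1 hsum.summable
  refine ⟨?_, hsummable, ?_⟩
  · rw [hE]
    exact intervalIntegrable_rahmanKernel hq _ ha hb hc hd hr 0 Real.pi
  · have hval := hsum.tsum_eq
    rw [tsum_mul_left, integral_rahmanKernel_half hq _ ha hb hc hd hr, hR] at hval
    rw [hE, veryWellPoised, basicPhi]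
    change _ * (∑' k, basicPhiTerm _ _ _ _ k) = _ at hval
    generalize (∑' k, basicPhiTerm _ _ _ _ k) = W at hval ⊢
    have m1 := qShiftInf_ne_zero hq hB
    have m2 := qShiftInf_ne_zero hq hp
    have m3 := qShiftInf_ne_zero hq hBz
    have m4 := qShiftInf_ne_zero hq hconv
    simp only [qShiftMultiInf, Fin.prod_univ_succ, Matrix.cons_val_zero, Matrix.cons_val_succ,
      Fin.prod_univ_zero, mul_one]
    generalize (∫ θ in (0 : ℝ)..Real.pi,
      rahmanKernel q (a * b * c * d * r * z) a b c d r (circleMap 0 1 θ)) = J at hval ⊢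
    generalize qShiftInf q (a ^ 2 * b * c * d * r) = x1 at *
    generalize qShiftInf q (b * c * d * r) = x2 at *
    generalize qShiftInf q (a ^ 2 * b * c * d * r * z) = x3 at *
    generalize qShiftInf q (b * c * d * r * z) = x4 at *
    have hJ : J = x3 * x4 / (x1 * x2) * (x1 * x2 / (x3 * x4) * (2 * J)) / 2 := by
      field_simp
    rw [hJ, ← hval]
    -- `(bcdr; q)_∞` occurs both in the balanced integral and in the prefactor of the expansion. It
    -- is absent from the final formula, so `x2 * x2⁻¹` is inserted there before `ring`.
    have hx2 : x2 * x2⁻¹ = 1 := mul_inv_cancel₀ m2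
    simp only [div_eq_mul_inv, mul_inv]
    have e : ∀ T : ℂ, T = T * (x2 * x2⁻¹) := fun T => by rw [hx2, mul_one]
    rw [e (2 * (Real.pi : ℂ) * _ * _ * _)]
    ring
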